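/- Let $S^2\subset\mathbb R^3$ be the unit sphere with its surface measure, let $\|\cdot\|_p$ be the norm of $L^p(S^2)$ and $\langle f,g\rangle=\int_{S^2}f\overline g$. Let $\mathcal{SH}_k$ be the space of complex spherical harmonics of degree $k$, i.e. the restrictions to $S^2$ of the homogeneous harmonic polynomials of degree $k$ in three variables, whose dimension is $2k+1$. Let $Q_k\in\mathcal{SH}_k$ be the Gaussian beam, i.e. the $L^2$-normalised sectoral harmonic proportional to $(x_1+ix_2)^k=(\sin\phi)^ke^{ik\theta}$. For $2<p\le 6$ put $\sigma(p)=\frac12\left(\frac12-\frac1p\right)$. Then: (a) For every $2<p\le6$ the limit $C_p=\lim_{k\to\infty}\|Q_k\|_p/k^{\sigma(p)}$ exists and $0<C_p<\infty$. (b) Let $0<D<1$ satisfy $(7+1296D)\,c_0^{-1/D}\le\frac1{25}$ with $c_0=e^{1/72}$ (for example, $D=1/400$ satisfies this). Then there is $k_0$, depending only on $D$, such that for every $k\ge k_0$ there is an orthonormal basis $\{u_i\}_{i=1}^{2k+1}$ of $\mathcal{SH}_k$ such that, simultaneously for all $2<p\le 6$, $$\frac1{2k+1}\sum_{i=1}^{2k+1}\|u_i\|_p\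 \ge\ \frac D3\,\|Q_k\|_p\qquad\text{and}\qquad \frac1{2k+1}\sum_{i=1}^{2k+1}\|u_i\|_p\ \ge\ \frac D3\,C_p\,k^{\sigma(p)}.$$ Thus the average $L^p$ norm of these bases grows at least at the polynomial rate $k^{\sigma(p)}$ of the Gaussian beams. -/

import Mathlib

open MeasureTheory

noncomputable section

/-- The unit sphere `S²` in Euclidean space `ℝ³`. -/
abbrev UnitSphere2 : Type := Metric.sphere (0 : EuclideanSpace ℝ (Fin 3)) 1

/-- The surface measure of the round metric on `S²` (of total mass `4π`). -/
def surfaceMeasure : Measure UnitSphere2 :=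
  (volume : Measure (EuclideanSpace ℝ (Fin 3))).toSphere

/-- The Laplacian `∂₁² + ∂₂² + ∂₃²` on complex polynomials in three variables. -/
def polyLaplacian : MvPolynomial (Fin 3) ℂ →ₗ[ℂ] MvPolynomial (Fin 3) ℂ :=
  ∑ i : Fin 3, (MvPolynomial.pderiv i).toLinearMap ∘ₗ (MvPolynomial.pderiv i).toLinearMap

/-- The restriction of a polynomial in three variables to the sphere. -/
def restrictToSphere : MvPolynomial (Fin 3) ℂ →ₗ[ℂ] (UnitSphere2 → ℂ) where
  toFun P := fun x => MvPolynomial.eval (fun i => ((x : EuclideanSpace ℝ (Fin 3)) i : ℂ)) P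
  map_add' P Q := by ext x; simp
  map_smul' c P := by ext x; simp [MvPolynomial.smul_eval]

/-- The spherical harmonics of degree `k`: restrictions to the sphere of the homogeneous harmonic
polynomials of degree `k`. -/
def sphericalHarmonics (k : ℕ) : Submodule ℂ (UnitSphere2 → ℂ) :=
  (MvPolynomial.homogeneousSubmodule (Fin 3) ℂ k ⊓ LinearMap.ker polyLaplacian).map
    restrictToSphere

/-- The inner product `⟨f, g⟩ = ∫_{S²} f ḡ`. -/
def sphereInner (f g : UnitSphere2 → ℂ) : ℂ :=
  ∫ x, f x * (starRingEnd ℂ) (g x) ∂surfaceMeasure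

/-- The `L^p` norm on the sphere, for real `p`. -/
def sphereNorm (p : ℝ) (f : UnitSphere2 → ℂ) : ℝ :=
  (eLpNorm f (ENNReal.ofReal p) surfaceMeasure).toReal

/-- `u` is an orthonormal basis of the space of degree-`k` spherical harmonics. -/
structure IsSphericalHarmonicBasis (k : ℕ) (u : Fin (2 * k + 1) → UnitSphere2 → ℂ) : Prop where
  mem : ∀ i, u i ∈ sphericalHarmonics k
  orthonormal : ∀ i j, sphereInner (u i) (u j) = if i = j then 1 else 0
  span_eq : Submodule.span ℂ (Set.range u) = sphericalHarmonics k

/-- The unnormalised sectoral harmonic `(x₁ + i x₂)^k`, which is `(sin φ)^k e^{ikθ}` in the polar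
coordinates `x = (sin φ cos θ, sin φ sin θ, cos φ)`; since the associated Legendre function
`P_k^k(cos φ)` is a nonzero constant times `(sin φ)^k`, it is proportional to
`P_k^k(cos φ) e^{ikθ}`. -/
def sectoralHarmonic (k : ℕ) (x : UnitSphere2) : ℂ :=
  (((x : EuclideanSpace ℝ (Fin 3)) 0 : ℂ) + Complex.I * ((x : EuclideanSpace ℝ (Fin 3)) 1 : ℂ)) ^ k

/-- The Gaussian beam `Q_k`: the sectoral harmonic, normalised in `L²(S²)`. -/
def gaussianBeam (k : ℕ) (x : UnitSphere2) : ℂ :=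
  ((sphereNorm 2 (sectoralHarmonic k) : ℂ))⁻¹ * sectoralHarmonic k x

/-- The exponent `σ(p)` of a surface, in the range `2 < p ≤ 6`. -/
def soggeExponent (p : ℝ) : ℝ := (1 / 2) * (1 / 2 - 1 / p)

/-- The admissible densities: `0 < D < 1` and `(7 + 1296 D) c₀^{-1/D} ≤ 1/25`, where
`c₀ = e^{1/72}`. -/
def IsAdmissibleDensity (D : ℝ) : Prop :=
  0 < D ∧ D < 1 ∧ (7 + 1296 * D) * Real.exp (1 / 72) ^ (-1 / D) ≤ 1 / 25

end

/-!
The bases are built from a lattice of rotated Gaussian beams, completed by Gram–Schmidt.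

For an isotropic `w ∈ ℂ³` (that is, `w · w = 0`) the restriction of `(w · x)^k` to the sphere is a
spherical harmonic. If moreover `w · w̄ = 2`, then it is a rotation of the sectoral harmonic, so all
these functions have the same `L^p` norm for each `p` (`sphereNorm_dotForm_pow`). Integrals over the
sphere of homogeneous functions are Gaussian integrals over space
(`integral_homogeneous_mul_gaussian`). Integration by parts in the latter shows that the inner
product of `(w · x)^k` and `(v · x)^k` is `c_k (w · v̄)^k` (`exists_sphereInner_dotForm_pow`). In
stereographic coordinates `z`, `ζ` of the poles, the overlap of two normalised beams is therefore
`(1 - |z - ζ|² / ((1 + |z|²)(1 + |ζ|²)))^k` (`norm_inner_rotatedBeam`), which decays like a Gaussian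
at distances of order `k^(-1/2)`.

Hence the beams with poles in an `M × M` lattice in the unit square, `M² ≈ k / 27`, have a Gram
matrix whose off-diagonal row sums are at most `1/4` (`sum_norm_inner_latticeBeam_le`). In the
Gram–Schmidt process each beam is corrected by a combination of the earlier ones whose coefficients
have `ℓ¹` norm at most `1/3`, and the normalisation only enlarges the result
(`exists_orthonormalBasis_of_nearly_orthogonal`). As all beams have the same `L^p` norm, each of the
`M²` resulting basis elements has `L^p` norm at least two thirds of it, for all `p` at once. The
dimension of the space is `2 k + 1` (`finrank_sphericalHarmonics`), so the average is at least
`‖Q_k‖_p / 486`, whereas an admissible `D` is at most `1 / 360` (`IsAdmissibleDensity.le`), so that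
`2 D / 3 ≤ 1 / 540`.

The norms of the beams are explicit quotients of Gamma values (`integral_norm_dotForm_rpow`).
Log-convexity of the Gamma function gives two-sided bounds for these quotients
(`beamMoment_sq_bounds`), from which both the limit (`tendsto_sphereNorm_gaussianBeam`) and a
comparison with it, uniform in `p`, follow (`beamConstant_mul_le`).
-/

/-! ### Polar coordinates and Gaussian integrals of polynomials -/

/-- Polar coordinates for a function that is homogeneous of degree `a`, weighted by the Gaussian
`exp (-‖x‖²)`: its integral over space is its integral over the sphere times a radial factor. -/
lemma integral_homogeneous_mul_gaussian (F : EuclideanSpace ℝ (Fin 3) → ℂ) (a : ℝ)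
    (hF : ∀ r : ℝ, 0 < r → ∀ x, F (r • x) = ((r ^ a : ℝ) : ℂ) * F x) :
    ∫ x, F x * (Real.exp (-‖x‖ ^ 2) : ℂ) =
      (∫ x : UnitSphere2, F x ∂surfaceMeasure) *
        ((∫ r in Set.Ioi (0 : ℝ), r ^ (a + 2) * Real.exp (-r ^ (2 : ℝ)) : ℝ) : ℂ) := by
  let E := EuclideanSpace ℝ (Fin 3)
  have hdim : Module.finrank ℝ E = 3 := by simp [E]
  calc ∫ x : E, F x * (Real.exp (-‖x‖ ^ 2) : ℂ)
      = ∫ x : ({(0)}ᶜ : Set E), F x * (Real.exp (-‖(x : E)‖ ^ 2) : ℂ)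
          ∂((volume : Measure E).comap (↑)) := by
        rw [integral_subtype_comap (measurableSet_singleton _).compl
          fun x : E ↦ F x * (Real.exp (-‖x‖ ^ 2) : ℂ), restrict_compl_singleton]
    _ = ∫ x : UnitSphere2 × Set.Ioi (0 : ℝ),
          F x.1 * (((x.2 : ℝ) ^ a * Real.exp (-(x.2 : ℝ) ^ 2) : ℝ) : ℂ)
          ∂(surfaceMeasure.prod (Measure.volumeIoiPow (Module.finrank ℝ E - 1))) := by
        rw [surfaceMeasure,
          ← (volume : Measure E).measurePreserving_homeomorphUnitSphereProd.integral_comp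
            (Homeomorph.measurableEmbedding _)]
        refine integral_congr_ae (Filter.Eventually.of_forall fun x => ?_)
        have hx : 0 < ‖(x : E)‖ := norm_pos_iff.2 x.2
        have h2 : F (x : E) = ((‖(x : E)‖ ^ a : ℝ) : ℂ) * F (‖(x : E)‖⁻¹ • (x : E)) := by
          rw [← hF _ hx, smul_smul, mul_inv_cancel₀ hx.ne', one_smul]
        simp only [homeomorphUnitSphereProd_apply_fst_coe, homeomorphUnitSphereProd_apply_snd_coe]
        rw [h2]; push_cast; ring
    _ = (∫ x : UnitSphere2, F x ∂surfaceMeasure) *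
          ∫ r : Set.Ioi (0 : ℝ), (((r : ℝ) ^ a * Real.exp (-(r : ℝ) ^ 2) : ℝ) : ℂ)
            ∂(Measure.volumeIoiPow (Module.finrank ℝ E - 1)) := by
        have : IsFiniteMeasure surfaceMeasure := by unfold surfaceMeasure; infer_instance
        rw [← integral_prod_mul]
    _ = _ := by
        congr 1
        rw [integral_complex_ofReal]
        congr 1
        simp only [Measure.volumeIoiPow, ENNReal.ofReal, hdim]
        rw [integral_withDensity_eq_integral_smul,
          integral_subtype_comap measurableSet_Ioi fun r : ℝ ↦
            Real.toNNReal (r ^ (3 - 1)) • (r ^ a * Real.exp (-r ^ 2)),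
          setIntegral_congr_fun measurableSet_Ioi fun r hr ↦ ?_]
        · have hr : 0 < r := hr
          simp only [NNReal.smul_def, Real.coe_toNNReal _ (pow_nonneg hr.le _), smul_eq_mul]
          simp only [Real.rpow_add hr, Real.rpow_two]; ring
        · exact (measurable_subtype_coe.pow_const _).real_toNNReal

/-- The radial factor of `integral_homogeneous_mul_gaussian`. -/
lemma integral_radial_gaussian (a : ℝ) (ha : 0 ≤ a) :
    ∫ r in Set.Ioi (0 : ℝ), r ^ (a + 2) * Real.exp (-r ^ (2 : ℝ)) =
      1 / 2 * Real.Gamma ((a + 3) / 2) := by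
  rw [integral_rpow_mul_exp_neg_rpow (by norm_num) (by linarith)]
  norm_num [add_assoc]

lemma integrable_pow_mul_gaussian (n : ℕ) :
    Integrable (fun t : ℝ => (t : ℂ) ^ n * (Real.exp (-t ^ 2) : ℂ)) := by
  have h := integrable_rpow_mul_exp_neg_mul_sq (b := 1) one_pos (s := n)
    (by have : (0 : ℝ) ≤ n := n.cast_nonneg
        linarith)
  have h2 := h.ofReal (𝕜 := ℂ)
  simpa using h2

/-- The recursion of the Gaussian moments, by integration by parts. -/
lemma integral_pow_succ_mul_gaussian (n : ℕ) :
    ∫ t : ℝ, (t : ℂ) ^ (n + 1) * (Real.exp (-t ^ 2) : ℂ) =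
      n / 2 * ∫ t : ℝ, (t : ℂ) ^ (n - 1) * (Real.exp (-t ^ 2) : ℂ) := by
  have hu : ∀ t : ℝ, HasDerivAt (fun t : ℝ => (t : ℂ) ^ n) ((n : ℂ) * (t : ℂ) ^ (n - 1)) t := by
    intro t
    simpa using (hasDerivAt_pow n (t : ℂ)).comp_ofReal
  have hv : ∀ t : ℝ, HasDerivAt (fun t : ℝ => -(1 / 2 : ℂ) * (Real.exp (-t ^ 2) : ℂ))
      ((t : ℂ) * (Real.exp (-t ^ 2) : ℂ)) t := by
    intro t
    have h1 : HasDerivAt (fun t : ℝ => Real.exp (-t ^ 2)) (Real.exp (-t ^ 2) * (-(2 * t))) t := by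
      simpa using ((hasDerivAt_pow 2 t).neg).exp
    refine (h1.ofReal_comp.const_mul (-(1 / 2 : ℂ))).congr_deriv ?_
    push_cast; ring
  have key := integral_mul_deriv_eq_deriv_mul_of_integrable (fun t _ => hu t) (fun t _ => hv t)
    ?_ ?_ ?_
  · calc _ = ∫ t : ℝ, (t : ℂ) ^ n * ((t : ℂ) * (Real.exp (-t ^ 2) : ℂ)) := by
          congr 1; ext t; ring
      _ = _ := by
          rw [key, ← integral_const_mul, ← integral_neg]
          congr 1; ext t; ring
  · refine (integrable_pow_mul_gaussian (n + 1)).congr (Filter.Eventually.of_forall fun t => ?_)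
    simp only [Pi.mul_apply]; ring
  · refine ((integrable_pow_mul_gaussian (n - 1)).const_mul (-(1 / 2 : ℂ) * n)).congr
      (Filter.Eventually.of_forall fun t => ?_)
    simp only [Pi.mul_apply]; ring
  · refine ((integrable_pow_mul_gaussian n).const_mul (-(1 / 2 : ℂ))).congr
      (Filter.Eventually.of_forall fun t => ?_)
    simp only [Pi.mul_apply]; ring

/-- The value of a complex polynomial at a point of real Euclidean space. -/
noncomputable def realEval (x : EuclideanSpace ℝ (Fin 3)) : MvPolynomial (Fin 3) ℂ →+* ℂ :=
  MvPolynomial.eval fun i => (x i : ℂ)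

lemma continuous_realEval (P : MvPolynomial (Fin 3) ℂ) : Continuous fun x => realEval x P := by
  unfold realEval
  exact (MvPolynomial.continuous_eval P).comp (by fun_prop)

lemma realEval_monomial_mul_gaussian (m : Fin 3 →₀ ℕ) (x : Fin 3 → ℝ) :
    realEval (WithLp.toLp 2 x) (MvPolynomial.monomial m 1) *
        (Real.exp (-‖WithLp.toLp 2 x‖ ^ 2) : ℂ) =
      ∏ i, ((x i : ℂ) ^ m i * (Real.exp (-x i ^ 2) : ℂ)) := by
  rw [Finset.prod_mul_distrib, realEval, MvPolynomial.eval_monomial, one_mul,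
    Finsupp.prod_fintype _ _ (by simp), ← Complex.ofReal_prod, ← Real.exp_sum,
    EuclideanSpace.norm_sq_eq]
  simp

lemma integrable_realEval_mul_gaussian (P : MvPolynomial (Fin 3) ℂ) :
    Integrable fun x => realEval x P * (Real.exp (-‖x‖ ^ 2) : ℂ) := by
  induction P using MvPolynomial.induction_on' with
  | monomial m c =>
    have h1 : Integrable fun x => realEval x (MvPolynomial.monomial m 1) *
        (Real.exp (-‖x‖ ^ 2) : ℂ) := by
      rw [← (PiLp.volume_preserving_toLp (Fin 3)).integrable_comp_emb
        (MeasurableEquiv.toLp 2 _).measurableEmbedding]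
      refine (Integrable.fintype_prod (f := fun i (t : ℝ) =>
        (t : ℂ) ^ m i * (Real.exp (-t ^ 2) : ℂ)) fun i => integrable_pow_mul_gaussian (m i)).congr
        (Filter.Eventually.of_forall fun x => ?_)
      exact (realEval_monomial_mul_gaussian m x).symm
    refine (h1.const_mul c).congr (Filter.Eventually.of_forall fun x => ?_)
    simp only [realEval, MvPolynomial.eval_monomial]
    ring
  | add P Q hP hQ =>
    refine (hP.add hQ).congr (Filter.Eventually.of_forall fun x => ?_)
    simp only [Pi.add_apply, map_add, add_mul]

/-- The linear functional `P ↦ ∫_{ℝ³} P(x) exp(-‖x‖²) dx` on complex polynomials. -/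
noncomputable def gaussianFunctional : MvPolynomial (Fin 3) ℂ →ₗ[ℂ] ℂ where
  toFun P := ∫ x, realEval x P * (Real.exp (-‖x‖ ^ 2) : ℂ)
  map_add' P Q := by
    rw [← integral_add (integrable_realEval_mul_gaussian P) (integrable_realEval_mul_gaussian Q)]
    simp only [map_add, add_mul]
  map_smul' c P := by
    simp only [RingHom.id_apply, smul_eq_mul]
    rw [← integral_const_mul]
    simp only [realEval, MvPolynomial.smul_eval, mul_assoc]

lemma gaussianFunctional_apply (P : MvPolynomial (Fin 3) ℂ) :
    gaussianFunctional P = ∫ x, realEval x P * (Real.exp (-‖x‖ ^ 2) : ℂ) := rfl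

lemma gaussianFunctional_monomial (m : Fin 3 →₀ ℕ) (c : ℂ) :
    gaussianFunctional (MvPolynomial.monomial m c) =
      c * ∏ i, ∫ t : ℝ, (t : ℂ) ^ m i * (Real.exp (-t ^ 2) : ℂ) := by
  have h : MvPolynomial.monomial m c = c • MvPolynomial.monomial m (1 : ℂ) := by
    rw [MvPolynomial.smul_monomial, smul_eq_mul, mul_one]
  rw [h, map_smul, smul_eq_mul, gaussianFunctional_apply,
    ← (PiLp.volume_preserving_toLp (Fin 3)).integral_comp
      (MeasurableEquiv.toLp 2 _).measurableEmbedding]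
  simp only [realEval_monomial_mul_gaussian]
  rw [integral_fintype_prod_volume_eq_prod
    (f := fun i (t : ℝ) => (t : ℂ) ^ m i * (Real.exp (-t ^ 2) : ℂ))]

/-- Integration by parts for the Gaussian functional. -/
lemma gaussianFunctional_X_mul (i : Fin 3) (P : MvPolynomial (Fin 3) ℂ) :
    gaussianFunctional (MvPolynomial.X i * P) =
      1 / 2 * gaussianFunctional (MvPolynomial.pderiv i P) := by
  induction P using MvPolynomial.induction_on' with
  | monomial m c =>
    rw [MvPolynomial.X, MvPolynomial.monomial_mul, MvPolynomial.pderiv_monomial,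
      gaussianFunctional_monomial, gaussianFunctional_monomial,
      ← Finset.mul_prod_erase _ _ (Finset.mem_univ i),
      ← Finset.mul_prod_erase _ _ (Finset.mem_univ i)]
    have h1 : (Finsupp.single i 1 + m : Fin 3 →₀ ℕ) i = m i + 1 := by simp [add_comm]
    have h2 : (m - Finsupp.single i 1 : Fin 3 →₀ ℕ) i = m i - 1 := by simp
    have h3 : ∀ j ∈ Finset.univ.erase i,
        (Finsupp.single i 1 + m : Fin 3 →₀ ℕ) j = (m - Finsupp.single i 1 : Fin 3 →₀ ℕ) j := by
      intro j hj
      simp [(Finset.ne_of_mem_erase hj).symm]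
    rw [h1, h2, integral_pow_succ_mul_gaussian, Finset.prod_congr rfl fun j hj => by rw [h3 j hj]]
    ring
  | add P Q hP hQ => rw [mul_add, map_add, map_add, map_add, hP, hQ]; ring

/-- The linear form `x ↦ ∑ wᵢ xᵢ` with complex coefficients. -/
noncomputable def dotForm (w : Fin 3 → ℂ) : MvPolynomial (Fin 3) ℂ := ∑ i, w i • MvPolynomial.X i

lemma pderiv_dotForm (w : Fin 3 → ℂ) (i : Fin 3) :
    MvPolynomial.pderiv i (dotForm w) = MvPolynomial.C (w i) := by
  simp only [dotForm, map_sum, Derivation.map_smul, MvPolynomial.pderiv_X, Pi.single_apply]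
  simp [MvPolynomial.smul_eq_C_mul]

lemma gaussianFunctional_dotForm_mul (w : Fin 3 → ℂ) (P : MvPolynomial (Fin 3) ℂ) :
    gaussianFunctional (dotForm w * P) =
      1 / 2 * ∑ i, w i * gaussianFunctional (MvPolynomial.pderiv i P) := by
  rw [dotForm, Finset.sum_mul, map_sum, Finset.mul_sum]
  refine Finset.sum_congr rfl fun i _ => ?_
  rw [smul_mul_assoc, map_smul, smul_eq_mul, gaussianFunctional_X_mul]
  ring

/-- If `w` is isotropic, moving all the factors of `(w · x)^k` by integration by parts onto
`(u · x)^k` leaves only powers of `w · u`. -/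
lemma gaussianFunctional_dotForm_pow_mul_pow {w : Fin 3 → ℂ} (hw : w ⬝ᵥ w = 0) (u : Fin 3 → ℂ)
    (k : ℕ) :
    gaussianFunctional (dotForm w ^ k * dotForm u ^ k) =
      (k.factorial / 2 ^ k * gaussianFunctional 1) * (w ⬝ᵥ u) ^ k := by
  induction k with
  | zero => simp
  | succ n ih =>
    have hd : ∀ i, MvPolynomial.pderiv i (dotForm w ^ n * dotForm u ^ (n + 1)) =
        w i • ((n : ℂ) • (dotForm w ^ (n - 1) * dotForm u ^ (n + 1))) +
          u i • (((n : ℂ) + 1) • (dotForm w ^ n * dotForm u ^ n)) := by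
      intro i
      rw [Derivation.leibniz, Derivation.leibniz_pow, Derivation.leibniz_pow, pderiv_dotForm,
        pderiv_dotForm]
      simp only [MvPolynomial.smul_eq_C_mul, smul_eq_mul, nsmul_eq_mul, Nat.add_sub_cancel,
        map_add, map_natCast, map_one, Nat.cast_add, Nat.cast_one]
      ring
    rw [pow_succ' (dotForm w), mul_assoc, gaussianFunctional_dotForm_mul]
    simp only [hd, map_add, map_smul, smul_eq_mul, ih, mul_add, Finset.sum_add_distrib,
      ← mul_assoc, ← Finset.sum_mul]
    have h1 : ∑ i, w i * w i = 0 := hw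
    have h2 : ∑ i, w i * u i = w ⬝ᵥ u := rfl
    simp only [h1, h2, Nat.factorial_succ]
    push_cast
    ring

/-! ### Integrals of powers of isotropic linear forms over the sphere -/

instance : IsFiniteMeasure surfaceMeasure := by unfold surfaceMeasure; infer_instance

instance : surfaceMeasure.IsOpenPosMeasure := by unfold surfaceMeasure; infer_instance

lemma restrictToSphere_apply (P : MvPolynomial (Fin 3) ℂ) (x : UnitSphere2) :
    restrictToSphere P x = realEval x P := rfl

lemma continuous_restrictToSphere (P : MvPolynomial (Fin 3) ℂ) :
    Continuous (restrictToSphere P) :=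
  (continuous_realEval P).comp continuous_subtype_val

lemma memLp_of_continuous_sphere {f : UnitSphere2 → ℂ} (hf : Continuous f) (p : ENNReal) :
    MemLp f p surfaceMeasure :=
  (hf.memLp_top_of_hasCompactSupport (HasCompactSupport.of_compactSpace f) _).mono_exponent le_top

lemma sphereNorm_eq_integral {f : UnitSphere2 → ℂ} (hf : Continuous f) {p : ℝ} (hp : 0 < p) :
    sphereNorm p f = (∫ x, ‖f x‖ ^ p ∂surfaceMeasure) ^ (1 / p) := by
  rw [sphereNorm, (memLp_of_continuous_sphere hf _).eLpNorm_eq_integral_rpow_norm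
    (by simpa using hp) ENNReal.ofReal_ne_top, ENNReal.toReal_ofReal hp.le, ENNReal.toReal_ofReal
    (by positivity), one_div]

lemma realEval_dotForm (w : Fin 3 → ℂ) (x : EuclideanSpace ℝ (Fin 3)) :
    realEval x (dotForm w) = ∑ i, w i * (x i : ℂ) := by
  simp [realEval, dotForm, MvPolynomial.smul_eval]

/-- The Gaussian integral of `|x₁ + i x₂|^s`, computed in cylindrical coordinates. -/
lemma integral_norm_rpow_mul_gaussian {s : ℝ} (hs : 0 ≤ s) :
    ∫ x : EuclideanSpace ℝ (Fin 3), ‖(x 0 : ℂ) + Complex.I * x 1‖ ^ s * Real.exp (-‖x‖ ^ 2) =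
      √Real.pi * (Real.pi * Real.Gamma (s / 2 + 1)) := by
  let G : ℝ → ℝ := fun t => Real.exp (-1 * t ^ 2)
  let H : ℂ → ℝ := fun z => ‖z‖ ^ s * Real.exp (-‖z‖ ^ (2 : ℝ))
  have hexp : ∀ x : Fin 3 → ℝ, ‖(x 0 : ℂ) + Complex.I * x 1‖ ^ s *
      Real.exp (-‖WithLp.toLp 2 x‖ ^ 2) = G (x 2) * H ((x 0 : ℂ) + Complex.I * x 1) := by
    intro x
    simp only [G, H]
    have h1 : ‖(x 0 : ℂ) + Complex.I * x 1‖ ^ 2 = x 0 ^ 2 + x 1 ^ 2 := by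
      rw [mul_comm, Complex.norm_add_mul_I, Real.sq_sqrt (by positivity)]
    rw [mul_left_comm, ← Real.exp_add, Real.rpow_two, h1, EuclideanSpace.norm_sq_eq,
      Fin.sum_univ_three]
    simp only [Real.norm_eq_abs, sq_abs]
    congr 2; ring
  calc _ = ∫ x : Fin 3 → ℝ, G (x 2) * H ((x 0 : ℂ) + Complex.I * x 1) := by
        rw [← (PiLp.volume_preserving_toLp (Fin 3)).integral_comp
          (MeasurableEquiv.toLp 2 _).measurableEmbedding]
        exact integral_congr_ae (Filter.Eventually.of_forall hexp)
    _ = ∫ y : ℝ × (Fin 2 → ℝ), G y.1 * H ((y.2 0 : ℂ) + Complex.I * y.2 1) := by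
        rw [← (volume_preserving_piFinSuccAbove (fun _ : Fin 3 => ℝ) 2).integral_comp
          (MeasurableEquiv.measurableEmbedding _)]
        rfl
    _ = (∫ t, G t) * ∫ y : Fin 2 → ℝ, H ((y 0 : ℂ) + Complex.I * y 1) := by
        rw [Measure.volume_eq_prod]
        exact integral_prod_mul (f := G) (g := fun y : Fin 2 → ℝ => H ((y 0 : ℂ) + Complex.I * y 1))
    _ = (∫ t, G t) * ∫ z, H z := by
        rw [← Complex.volume_preserving_equiv_pi.integral_comp
          (MeasurableEquiv.measurableEmbedding _)]
        congr 2; ext z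
        simp [Complex.measurableEquivPi_apply, mul_comm Complex.I, Complex.re_add_im]
    _ = _ := by
        simp only [G, H]
        rw [integral_gaussian, Complex.integral_rpow_mul_exp_neg_rpow (by norm_num) (by linarith)]
        congr 2
        · norm_num
        · norm_num
        · congr 1; ring

/-- A linear isometry carries every isotropic `w` with `w · w̄ = 2` to `(1, i, 0)`, since its real
and imaginary parts are orthonormal. -/
lemma exists_isometry_dotForm {w : Fin 3 → ℂ} (hw : w ⬝ᵥ w = 0) (hw2 : w ⬝ᵥ star w = 2) :
    ∃ e : EuclideanSpace ℝ (Fin 3) ≃ₗᵢ[ℝ] EuclideanSpace ℝ (Fin 3),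
      ∀ x, realEval x (dotForm w) = (e x 0 : ℂ) + Complex.I * e x 1 := by
  let v : Fin 3 → EuclideanSpace ℝ (Fin 3) :=
    ![WithLp.toLp 2 fun i => (w i).re, WithLp.toLp 2 fun i => (w i).im, 0]
  simp only [dotProduct, Fin.sum_univ_three, Pi.star_apply, Complex.ext_iff, Complex.add_re,
    Complex.add_im, Complex.mul_re, Complex.mul_im, Complex.star_def, Complex.conj_re,
    Complex.conj_im, Complex.zero_re, Complex.zero_im, Complex.re_ofNat, Complex.im_ofNat] at hw hw2
  have hv : Orthonormal ℝ (({0, 1} : Set (Fin 3)).domRestrict v) := by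
    rw [orthonormal_iff_ite]
    rintro ⟨i, rfl | rfl⟩ ⟨j, rfl | rfl⟩ <;>
      simp only [Set.domRestrict_apply, v, PiLp.inner_apply, Fin.sum_univ_three, RCLike.inner_apply,
        conj_trivial, Matrix.cons_val_zero, Matrix.cons_val_one, Subtype.ext_iff, Fin.isValue,
        zero_ne_one, one_ne_zero, if_true, if_false] <;> linarith [hw.1, hw.2, hw2.1]
  obtain ⟨b, hb⟩ := hv.exists_orthonormalBasis_extension_of_card_eq (by simp)
  refine ⟨b.repr, fun x => ?_⟩
  rw [OrthonormalBasis.repr_apply_apply, OrthonormalBasis.repr_apply_apply, hb 0 (by simp),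
    hb 1 (by simp), realEval_dotForm]
  simp only [v, PiLp.inner_apply, Fin.sum_univ_three]
  apply Complex.ext <;> simp <;> ring

/-- The integral `∫_{S²} |x₁ + i x₂|^s`, in closed form. -/
noncomputable def beamMoment (s : ℝ) : ℝ :=
  2 * Real.pi * √Real.pi * Real.Gamma (s / 2 + 1) / Real.Gamma (s / 2 + 3 / 2)

lemma integral_norm_dotForm_rpow {w : Fin 3 → ℂ} (hw : w ⬝ᵥ w = 0) (hw2 : w ⬝ᵥ star w = 2)
    {s : ℝ} (hs : 0 ≤ s) :
    ∫ x, ‖restrictToSphere (dotForm w) x‖ ^ s ∂surfaceMeasure = beamMoment s := by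
  obtain ⟨e, he⟩ := exists_isometry_dotForm hw hw2
  have h1 := integral_homogeneous_mul_gaussian
    (fun x => ((‖realEval x (dotForm w)‖ ^ s : ℝ) : ℂ)) s (by
      intro r hr x
      rw [← Complex.ofReal_mul, ← Real.mul_rpow hr.le (norm_nonneg _), he, he]
      congr 2
      rw [map_smul]
      simp only [PiLp.smul_apply, smul_eq_mul, Complex.ofReal_mul]
      rw [show (r : ℂ) * (e x 0) + Complex.I * (r * e x 1) = r * (e x 0 + Complex.I * e x 1) by ring,
        norm_mul, Complex.norm_real, Real.norm_of_nonneg hr.le])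
  simp only [← Complex.ofReal_mul, integral_complex_ofReal] at h1
  have h1 := Complex.ofReal_injective h1
  have h2 : ∫ x : EuclideanSpace ℝ (Fin 3), ‖realEval x (dotForm w)‖ ^ s * Real.exp (-‖x‖ ^ 2) =
      √Real.pi * (Real.pi * Real.Gamma (s / 2 + 1)) := by
    rw [← integral_norm_rpow_mul_gaussian hs, ← e.measurePreserving.integral_comp
      e.toHomeomorph.measurableEmbedding
      (fun x => ‖(x 0 : ℂ) + Complex.I * x 1‖ ^ s * Real.exp (-‖x‖ ^ 2))]
    simp only [he, e.norm_map]
  rw [h2, integral_radial_gaussian s hs, show (s + 3) / 2 = s / 2 + 3 / 2 by ring] at h1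
  have hG : 0 < Real.Gamma (s / 2 + 3 / 2) := Real.Gamma_pos_of_pos (by linarith)
  simp only [restrictToSphere_apply, beamMoment]
  rw [eq_div_iff hG.ne']
  linarith

lemma beamMoment_pos {s : ℝ} (hs : 0 ≤ s) : 0 < beamMoment s := by
  have h1 : 0 < Real.Gamma (s / 2 + 1) := Real.Gamma_pos_of_pos (by linarith)
  have h2 : 0 < Real.Gamma (s / 2 + 3 / 2) := Real.Gamma_pos_of_pos (by linarith)
  have := Real.pi_pos
  unfold beamMoment
  positivity

lemma sphereNorm_dotForm_pow {w : Fin 3 → ℂ} (hw : w ⬝ᵥ w = 0) (hw2 : w ⬝ᵥ star w = 2) (k : ℕ)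
    {p : ℝ} (hp : 0 < p) :
    sphereNorm p (restrictToSphere (dotForm w ^ k)) = beamMoment (k * p) ^ (1 / p) := by
  rw [sphereNorm_eq_integral (continuous_restrictToSphere _) hp,
    ← integral_norm_dotForm_rpow hw hw2 (by positivity)]
  simp only [restrictToSphere_apply, map_pow, norm_pow, Real.rpow_mul (norm_nonneg _),
    Real.rpow_natCast]

lemma realEval_smul {P : MvPolynomial (Fin 3) ℂ} {n : ℕ} (hP : P.IsHomogeneous n) (r : ℝ)
    (x : EuclideanSpace ℝ (Fin 3)) : realEval (r • x) P = (r : ℂ) ^ n * realEval x P := by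
  simp only [realEval, MvPolynomial.eval_eq', Finset.mul_sum]
  refine Finset.sum_congr rfl fun d hd => ?_
  have hdeg : ∑ i, d i = n := by
    rw [← hP (MvPolynomial.mem_support_iff.1 hd), Finsupp.weight_apply, Finsupp.sum_fintype] <;> simp
  simp only [PiLp.smul_apply, smul_eq_mul, Complex.ofReal_mul, mul_pow, Finset.prod_mul_distrib,
    Finset.prod_pow_eq_pow_sum, hdeg]
  ring

/-- Up to a factor depending on the degree, the integral of a homogeneous polynomial over the sphere
is its Gaussian integral over space. -/
lemma integral_restrictToSphere {P : MvPolynomial (Fin 3) ℂ} {n : ℕ} (hP : P.IsHomogeneous n) :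
    (∫ x, restrictToSphere P x ∂surfaceMeasure) * ((1 / 2 * Real.Gamma ((n + 3) / 2) : ℝ) : ℂ) =
      gaussianFunctional P := by
  rw [gaussianFunctional_apply, integral_homogeneous_mul_gaussian (fun x => realEval x P) n,
    integral_radial_gaussian _ (by positivity)]
  · rfl
  · intro r _ x
    rw [realEval_smul hP, Real.rpow_natCast, Complex.ofReal_pow]

lemma isHomogeneous_dotForm (w : Fin 3 → ℂ) : (dotForm w).IsHomogeneous 1 := by
  refine MvPolynomial.IsHomogeneous.sum _ _ _ fun i _ => ?_
  rw [MvPolynomial.smul_eq_C_mul]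
  simpa using (MvPolynomial.isHomogeneous_C _ (w i)).mul (MvPolynomial.isHomogeneous_X ℂ i)

lemma isHomogeneous_dotForm_pow (w : Fin 3 → ℂ) (k : ℕ) : (dotForm w ^ k).IsHomogeneous k := by
  simpa using (isHomogeneous_dotForm w).pow k

lemma star_restrictToSphere_dotForm_pow (v : Fin 3 → ℂ) (k : ℕ) (x : UnitSphere2) :
    (starRingEnd ℂ) (restrictToSphere (dotForm v ^ k) x) =
      restrictToSphere (dotForm (star v) ^ k) x := by
  simp [restrictToSphere_apply, realEval_dotForm]

/-- The pairing of two powers of linear forms, the first of them isotropic, is a function of the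
Hermitian product of the coefficient vectors alone. -/
lemma exists_sphereInner_dotForm_pow (k : ℕ) : ∃ c : ℂ, ∀ w v : Fin 3 → ℂ, w ⬝ᵥ w = 0 →
    sphereInner (restrictToSphere (dotForm w ^ k)) (restrictToSphere (dotForm v ^ k)) =
      c * (w ⬝ᵥ star v) ^ k := by
  have hΓ : ((1 / 2 * Real.Gamma (((k + k : ℕ) + 3) / 2) : ℝ) : ℂ) ≠ 0 := by
    have : 0 < Real.Gamma (((k + k : ℕ) + 3) / 2) := Real.Gamma_pos_of_pos (by positivity)
    exact_mod_cast (by positivity : (1 / 2 * Real.Gamma (((k + k : ℕ) + 3) / 2)) ≠ 0)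
  refine ⟨k.factorial / 2 ^ k * gaussianFunctional 1 /
    ((1 / 2 * Real.Gamma (((k + k : ℕ) + 3) / 2) : ℝ) : ℂ), fun w v hw => ?_⟩
  have h := integral_restrictToSphere
    ((isHomogeneous_dotForm_pow w k).mul (isHomogeneous_dotForm_pow (star v) k))
  rw [gaussianFunctional_dotForm_pow_mul_pow hw] at h
  rw [div_mul_eq_mul_div, eq_div_iff hΓ, ← h]
  simp only [sphereInner, star_restrictToSphere_dotForm_pow]
  simp only [restrictToSphere_apply, map_mul]

/-! ### The dimension of the space of spherical harmonics -/

lemma coeff_polyLaplacian (P : MvPolynomial (Fin 3) ℂ) (d : Fin 3 →₀ ℕ) :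
    (polyLaplacian P).coeff d =
      ∑ i, ((d i + 2 : ℂ) * (d i + 1)) * P.coeff (d + Finsupp.single i 2) := by
  induction P using MvPolynomial.induction_on' with
  | monomial m c =>
    simp only [polyLaplacian, LinearMap.sum_apply, LinearMap.comp_apply, Derivation.coeFn_coe,
      MvPolynomial.pderiv_monomial, MvPolynomial.coeff_sum, MvPolynomial.coeff_monomial]
    refine Finset.sum_congr rfl fun i _ => ?_
    by_cases h : m = d + Finsupp.single i 2
    · subst h
      have : (d + Finsupp.single i 2 - Finsupp.single i 1 - Finsupp.single i 1 : Fin 3 →₀ ℕ) = d := by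
        rw [tsub_tsub, ← Finsupp.single_add]; simp
      simp [this]; ring
    · rw [if_neg h]
      split_ifs with h2
      · subst h2
        have : m i = 0 ∨ m i = 1 := by
          by_contra! hc
          apply h
          ext j
          by_cases hj : i = j
          · subst hj; simp; omega
          · simp [Finsupp.single_eq_of_ne' hj]
        rcases this with h0 | h0 <;> simp [h0]
      · simp
  | add P Q hP hQ => simp only [map_add, MvPolynomial.coeff_add, hP, hQ, mul_add,
      Finset.sum_add_distrib]

lemma degree_add_single (d : Fin 3 →₀ ℕ) (i : Fin 3) (n : ℕ) :
    (d + Finsupp.single i n).degree = d.degree + n := by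
  simp

lemma mem_homogeneousSubmodule_iff_coeff {k : ℕ} {P : MvPolynomial (Fin 3) ℂ} :
    P ∈ MvPolynomial.homogeneousSubmodule (Fin 3) ℂ k ↔ ∀ d, d.degree ≠ k → P.coeff d = 0 := by
  rw [MvPolynomial.mem_homogeneousSubmodule]
  refine ⟨fun h d hd => h.coeff_eq_zero hd, fun h d hd => ?_⟩
  by_contra hc
  apply hd (h d _)
  rwa [Finsupp.degree_eq_weight_one]

/-- The multi-indices of degree `k` in three variables. -/
noncomputable def multiIndices (k : ℕ) : Finset (Fin 3 →₀ ℕ) := Finset.univ.finsuppAntidiag k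

lemma mem_multiIndices {k : ℕ} {d : Fin 3 →₀ ℕ} : d ∈ multiIndices k ↔ d.degree = k := by
  simp [multiIndices, Finset.mem_finsuppAntidiag, Finsupp.degree_eq_sum]

lemma card_multiIndices_filter_eq {k c : ℕ} (hc : c ≤ k + 1) :
    ((multiIndices k).filter fun d => d 2 = c).card = k + 1 - c := by
  rw [← Finset.card_range (k + 1 - c)]
  refine Finset.card_bij (fun d _ => d 0) ?_ ?_ ?_
  · intro d hd
    simp only [Finset.mem_filter, mem_multiIndices, Finsupp.degree_eq_sum, Fin.sum_univ_three] at hd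
    simp only [Finset.mem_range]; omega
  · intro d hd e he h
    simp only [Finset.mem_filter, mem_multiIndices, Finsupp.degree_eq_sum, Fin.sum_univ_three]
      at hd he
    ext i
    fin_cases i <;> simp <;> omega
  · intro a ha
    simp only [Finset.mem_range] at ha
    refine ⟨Finsupp.single 0 a + Finsupp.single 1 (k - c - a) + Finsupp.single 2 c, ?_, by simp⟩
    simp only [Finset.mem_filter, mem_multiIndices, degree_add_single, Finsupp.degree_single]
    refine ⟨by omega, by simp⟩

lemma card_multiIndices_filter_le_one (k : ℕ) :
    ((multiIndices k).filter fun d => d 2 ≤ 1).card = 2 * k + 1 := by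
  have h : ((multiIndices k).filter fun d => d 2 ≤ 1) =
      ((multiIndices k).filter fun d => d 2 = 0) ∪ ((multiIndices k).filter fun d => d 2 = 1) := by
    rw [← Finset.filter_or]
    refine Finset.filter_congr fun d _ => ?_
    omega
  rw [h, Finset.card_union_of_disjoint, card_multiIndices_filter_eq (by omega),
    card_multiIndices_filter_eq (by omega)]
  · omega
  · rw [Finset.disjoint_filter]
    intro d _ h0 h1
    omega

/-- The space of homogeneous harmonic polynomials of degree `k`. -/
noncomputable def harmonicPolys (k : ℕ) : Submodule ℂ (MvPolynomial (Fin 3) ℂ) :=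
  MvPolynomial.homogeneousSubmodule (Fin 3) ℂ k ⊓ LinearMap.ker polyLaplacian

/-- The coefficients of a polynomial at a finite set of multi-indices. -/
noncomputable def coeffMap (S : Finset (Fin 3 →₀ ℕ)) : MvPolynomial (Fin 3) ℂ →ₗ[ℂ] (S → ℂ) :=
  LinearMap.pi fun d => MvPolynomial.lcoeff ℂ d.1

lemma coeffMap_injOn_homogeneous (k : ℕ) {P : MvPolynomial (Fin 3) ℂ}
    (hP : P ∈ MvPolynomial.homogeneousSubmodule (Fin 3) ℂ k)
    (h : coeffMap (multiIndices k) P = 0) : P = 0 := by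
  ext d
  by_cases hd : d.degree = k
  · exact congr_fun h ⟨d, mem_multiIndices.2 hd⟩
  · simpa using mem_homogeneousSubmodule_iff_coeff.1 hP d hd

instance (k : ℕ) : FiniteDimensional ℂ (MvPolynomial.homogeneousSubmodule (Fin 3) ℂ k) := by
  refine FiniteDimensional.of_injective
    ((coeffMap (multiIndices k)).domRestrict (MvPolynomial.homogeneousSubmodule (Fin 3) ℂ k)) ?_
  rw [← LinearMap.ker_eq_bot, LinearMap.ker_eq_bot']
  intro P hP
  exact Subtype.ext (coeffMap_injOn_homogeneous k P.2 hP)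

lemma card_multiIndices_le_finrank (k : ℕ) :
    (multiIndices k).card ≤ Module.finrank ℂ (MvPolynomial.homogeneousSubmodule (Fin 3) ℂ k) := by
  have h := LinearMap.finrank_le_finrank_of_injective (f := LinearMap.codRestrict
    (MvPolynomial.homogeneousSubmodule (Fin 3) ℂ k)
    (∑ d : multiIndices k, (MvPolynomial.monomial d.1).comp (LinearMap.proj d) :
      (multiIndices k → ℂ) →ₗ[ℂ] MvPolynomial (Fin 3) ℂ) (fun f => by
        rw [LinearMap.sum_apply]
        exact Submodule.sum_mem _ fun d _ =>
          MvPolynomial.isHomogeneous_monomial _ (mem_multiIndices.1 d.2))) (by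
    intro f g hfg
    ext d
    have h1 := congr_arg (MvPolynomial.coeff d.1) (congr_arg Subtype.val hfg)
    simpa [MvPolynomial.coeff_sum, MvPolynomial.coeff_monomial, Subtype.val_inj] using h1)
  simpa using h

instance (k : ℕ) : FiniteDimensional ℂ (harmonicPolys k) :=
  Submodule.finiteDimensional_inf_left _ _

/-- A homogeneous harmonic polynomial is determined by its Cauchy data on the plane `x₃ = 0`,
since the Laplace equation expresses the coefficients at higher powers of `x₃` through those at
lower powers. -/
lemma eq_zero_of_cauchyData_eq_zero {k : ℕ} {P : MvPolynomial (Fin 3) ℂ} (hP : P ∈ harmonicPolys k)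
    (h : coeffMap ((multiIndices k).filter fun d => d 2 ≤ 1) P = 0) : P = 0 := by
  have key : ∀ n : ℕ, ∀ d : Fin 3 →₀ ℕ, d 2 = n → P.coeff d = 0 := by
    intro n
    induction n using Nat.strong_induction_on with
    | _ n ih =>
      intro d hd
      by_cases hk : d.degree = k
      · by_cases h1 : d 2 ≤ 1
        · exact congr_fun h ⟨d, Finset.mem_filter.2 ⟨mem_multiIndices.2 hk, h1⟩⟩
        · obtain ⟨e, rfl⟩ : ∃ e, d = e + Finsupp.single 2 2 :=
            ⟨d - Finsupp.single 2 2, by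
              rw [tsub_add_cancel_of_le]; rw [Finsupp.single_le_iff]; omega⟩
          have hΔ := coeff_polyLaplacian P e
          have h0 : polyLaplacian P = 0 := hP.2
          have he : e 2 + 2 = n := by simpa using hd
          rw [h0, MvPolynomial.coeff_zero, Fin.sum_univ_three,
            ih (e 2) (by omega) (e + Finsupp.single 0 2) (by simp),
            ih (e 2) (by omega) (e + Finsupp.single 1 2) (by simp)] at hΔ
          have h3 : ((e 2 + 2 : ℂ) * (e 2 + 1)) ≠ 0 := by
            exact_mod_cast (by positivity : ((e 2 + 2) * (e 2 + 1)) ≠ 0)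
          simpa [h3] using hΔ.symm
      · exact mem_homogeneousSubmodule_iff_coeff.1 hP.1 d hk
  ext d
  simpa using key _ d rfl

lemma finrank_harmonicPolys_le (k : ℕ) : Module.finrank ℂ (harmonicPolys k) ≤ 2 * k + 1 := by
  have h := LinearMap.finrank_le_finrank_of_injective
    (f := (coeffMap ((multiIndices k).filter fun d => d 2 ≤ 1)).domRestrict (harmonicPolys k)) (by
      rw [← LinearMap.ker_eq_bot, LinearMap.ker_eq_bot']
      intro P hP
      exact Subtype.ext (eq_zero_of_cauchyData_eq_zero P.2 hP))
  simpa [card_multiIndices_filter_le_one] using h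

/-- Harmonicity imposes one linear condition for each multi-index of degree `k - 2`, that is, for
each multi-index of degree `k` in which `x₃` has exponent at least two. -/
lemma le_finrank_harmonicPolys (k : ℕ) : 2 * k + 1 ≤ Module.finrank ℂ (harmonicPolys k) := by
  let H := MvPolynomial.homogeneousSubmodule (Fin 3) ℂ k
  let T := (multiIndices k).filter fun d => ¬ d 2 ≤ 1
  let φ : H →ₗ[ℂ] (T → ℂ) := (LinearMap.pi fun d : T =>
    (MvPolynomial.lcoeff ℂ (d.1 - Finsupp.single 2 2)).comp polyLaplacian).domRestrict H
  have h1 := φ.finrank_range_add_finrank_ker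
  have h2 : Module.finrank ℂ φ.range ≤ T.card := by
    simpa using Submodule.finrank_le φ.range
  have h3 : ((multiIndices k).filter fun d => d 2 ≤ 1).card + T.card = (multiIndices k).card :=
    Finset.card_filter_add_card_filter_not _
  have h4 : φ.ker.map H.subtype ≤ harmonicPolys k := by
    rintro _ ⟨P, hP, rfl⟩
    refine ⟨P.2, ?_⟩
    rw [SetLike.mem_coe, LinearMap.mem_ker]
    ext d
    rw [MvPolynomial.coeff_zero]
    by_cases hd : d.degree + 2 = k
    · have := congr_fun (LinearMap.mem_ker.1 hP) ⟨d + Finsupp.single 2 2, Finset.mem_filter.2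
        ⟨mem_multiIndices.2 (by rw [degree_add_single, hd]), by simp⟩⟩
      simpa [φ, MvPolynomial.lcoeff_apply] using this
    · rw [coeff_polyLaplacian]
      refine Finset.sum_eq_zero fun i _ => ?_
      have h0 : MvPolynomial.coeff (d + Finsupp.single i 2) (H.subtype P) = 0 :=
        mem_homogeneousSubmodule_iff_coeff.1 P.2 _ (by rwa [degree_add_single])
      rw [h0, mul_zero]
  have h5 : Module.finrank ℂ φ.ker ≤ Module.finrank ℂ (harmonicPolys k) := by
    rw [← Submodule.finrank_map_subtype_eq H φ.ker]
    exact Submodule.finrank_mono h4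
  have h6 := card_multiIndices_le_finrank k
  rw [card_multiIndices_filter_le_one] at h3
  change _ = Module.finrank ℂ H at h1
  change _ ≤ Module.finrank ℂ H at h6
  omega

/-- A homogeneous polynomial that vanishes on the sphere vanishes. -/
lemma eq_zero_of_restrictToSphere_eq_zero {k : ℕ} {P : MvPolynomial (Fin 3) ℂ}
    (hP : P.IsHomogeneous k) (h : restrictToSphere P = 0) : P = 0 := by
  have key : ∀ x : EuclideanSpace ℝ (Fin 3), x ≠ 0 → realEval x P = 0 := by
    intro x hx
    have h1 : x = ‖x‖ • (‖x‖⁻¹ • x) := by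
      rw [smul_smul, mul_inv_cancel₀ (norm_ne_zero_iff.2 hx), one_smul]
    have h2 : realEval (‖x‖⁻¹ • x) P = 0 :=
      congr_fun h ⟨‖x‖⁻¹ • x, by simp [norm_smul, hx]⟩
    rw [h1, realEval_smul hP, h2, mul_zero]
  refine MvPolynomial.funext_set (fun _ => ((↑) : ℝ → ℂ) '' Set.Ioi 0) (fun _ =>
    (Set.Ioi_infinite 0).image Complex.ofReal_injective.injOn) fun x hx => ?_
  choose y hy hyx using fun i => hx i (Set.mem_univ i)
  have h3 := key (WithLp.toLp 2 y) (fun h0 => by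
    have : y 0 = 0 := by simpa using congr_arg (fun z => z.ofLp 0) h0
    exact (hy 0).ne' this)
  rw [map_zero, ← h3, realEval]
  congr 2
  ext i
  exact (hyx i).symm

instance (k : ℕ) : FiniteDimensional ℂ (sphericalHarmonics k) :=
  inferInstanceAs (FiniteDimensional ℂ ((harmonicPolys k).map restrictToSphere))

theorem finrank_sphericalHarmonics (k : ℕ) :
    Module.finrank ℂ (sphericalHarmonics k) = 2 * k + 1 := by
  have h : Module.finrank ℂ ((harmonicPolys k).map restrictToSphere) =
      Module.finrank ℂ (harmonicPolys k) := by
    rw [← LinearMap.range_domRestrict]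
    refine LinearMap.finrank_range_of_inj ?_
    rw [← LinearMap.ker_eq_bot, LinearMap.ker_eq_bot']
    intro P hP
    exact Subtype.ext (eq_zero_of_restrictToSphere_eq_zero P.2.1 hP)
  exact h.trans (le_antisymm (finrank_harmonicPolys_le k) (le_finrank_harmonicPolys k))

/-! ### The norms of the Gaussian beams -/

/-- The coefficient vector of the form `x₁ + i x₂`. -/
noncomputable def sectoralVector : Fin 3 → ℂ := ![1, Complex.I, 0]

lemma sectoralVector_isotropic : sectoralVector ⬝ᵥ sectoralVector = 0 := by
  simp [sectoralVector, dotProduct, Fin.sum_univ_three]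

lemma sectoralVector_dot_star : sectoralVector ⬝ᵥ star sectoralVector = 2 := by
  simp [sectoralVector, dotProduct, Fin.sum_univ_three]
  norm_num

lemma sectoralHarmonic_eq (k : ℕ) :
    sectoralHarmonic k = restrictToSphere (dotForm sectoralVector ^ k) := by
  ext x
  simp [sectoralHarmonic, restrictToSphere_apply, realEval_dotForm, sectoralVector,
    Fin.sum_univ_three]

lemma sphereNorm_const_mul (p : ℝ) (c : ℂ) (f : UnitSphere2 → ℂ) :
    sphereNorm p (fun x => c * f x) = ‖c‖ * sphereNorm p f := by
  have h : (fun x => c * f x) = c • f := rfl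
  rw [sphereNorm, sphereNorm, h, eLpNorm_const_smul]
  simp

lemma sphereNorm_nonneg (p : ℝ) (f : UnitSphere2 → ℂ) : 0 ≤ sphereNorm p f :=
  ENNReal.toReal_nonneg

lemma sphereNorm_gaussianBeam (k : ℕ) {p : ℝ} (hp : 0 < p) :
    sphereNorm p (gaussianBeam k) =
      beamMoment (k * p) ^ (1 / p) / beamMoment (k * 2) ^ (1 / 2 : ℝ) := by
  have h : gaussianBeam k = fun x =>
    ((sphereNorm 2 (sectoralHarmonic k) : ℂ))⁻¹ * sectoralHarmonic k x := rfl
  rw [h, sphereNorm_const_mul, sectoralHarmonic_eq,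
    sphereNorm_dotForm_pow sectoralVector_isotropic sectoralVector_dot_star k hp,
    sphereNorm_dotForm_pow sectoralVector_isotropic sectoralVector_dot_star k two_pos, norm_inv,
    Complex.norm_real, Real.norm_of_nonneg (Real.rpow_nonneg (beamMoment_pos (by positivity)).le _)]
  ring

/-- Log-convexity of the Gamma function at a midpoint. -/
lemma Gamma_midpoint_sq_le {s t : ℝ} (hs : 0 < s) (ht : 0 < t) :
    Real.Gamma ((s + t) / 2) ^ 2 ≤ Real.Gamma s * Real.Gamma t := by
  have h := Real.Gamma_mul_add_mul_le_rpow_Gamma_mul_rpow_Gamma hs ht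
    (by norm_num : (0 : ℝ) < 1 / 2) (by norm_num : (0 : ℝ) < 1 / 2) (by norm_num)
  rw [← Real.sqrt_eq_rpow, ← Real.sqrt_eq_rpow,
    show 1 / 2 * s + 1 / 2 * t = (s + t) / 2 by ring] at h
  have h0 : 0 < Real.Gamma ((s + t) / 2) := Real.Gamma_pos_of_pos (by positivity)
  calc Real.Gamma ((s + t) / 2) ^ 2 ≤ (√(Real.Gamma s) * √(Real.Gamma t)) ^ 2 := by gcongr
    _ = _ := by
      rw [mul_pow, Real.sq_sqrt (Real.Gamma_pos_of_pos hs).le,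
        Real.sq_sqrt (Real.Gamma_pos_of_pos ht).le]

/-- The limit of `beamMoment s * √s` as `s → ∞`. -/
noncomputable def momentLimit : ℝ := 2 * Real.pi * √Real.pi * √2

lemma momentLimit_pos : 0 < momentLimit := by
  have := Real.pi_pos
  unfold momentLimit; positivity

/-- Both bounds come from log-convexity of `Γ` at the midpoints `s/2 + 1` and `s/2 + 3/2`. -/
lemma beamMoment_sq_bounds {s : ℝ} (hs : 0 < s) :
    momentLimit ^ 2 * (s / (s + 2)) ≤ (beamMoment s * √s) ^ 2 ∧
      (beamMoment s * √s) ^ 2 ≤ momentLimit ^ 2 := by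
  have hA : 0 < Real.Gamma (s / 2 + 1) := Real.Gamma_pos_of_pos (by linarith)
  have hB : 0 < Real.Gamma (s / 2 + 3 / 2) := Real.Gamma_pos_of_pos (by linarith)
  have hC : 0 < Real.Gamma (s / 2 + 1 / 2) := Real.Gamma_pos_of_pos (by linarith)
  have h1 := Gamma_midpoint_sq_le (s := s / 2 + 1 / 2) (t := s / 2 + 3 / 2) (by linarith)
    (by linarith)
  have h2 := Gamma_midpoint_sq_le (s := s / 2 + 1) (t := s / 2 + 1 + 1) (by linarith)
    (by linarith)
  have h3 : Real.Gamma (s / 2 + 3 / 2) = (s / 2 + 1 / 2) * Real.Gamma (s / 2 + 1 / 2) := by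
    rw [← Real.Gamma_add_one (by linarith)]; congr 1; ring
  rw [Real.Gamma_add_one (s := s / 2 + 1) (by linarith)] at h2
  rw [show (s / 2 + 1 / 2 + (s / 2 + 3 / 2)) / 2 = s / 2 + 1 by ring] at h1
  rw [show (s / 2 + 1 + (s / 2 + 1 + 1)) / 2 = s / 2 + 3 / 2 by ring] at h2
  have hC2 : Real.Gamma (s / 2 + 1 / 2) = Real.Gamma (s / 2 + 3 / 2) / (s / 2 + 1 / 2) := by
    rw [h3]; field_simp
  rw [hC2] at h1
  set A := Real.Gamma (s / 2 + 1)
  set B := Real.Gamma (s / 2 + 3 / 2)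
  have hM : (beamMoment s * √s) ^ 2 = momentLimit ^ 2 * (A ^ 2 / B ^ 2 * (s / 2)) := by
    have h4 : √(2 : ℝ) ^ 2 = 2 := Real.sq_sqrt (by norm_num)
    have h5 : beamMoment s = 2 * Real.pi * √Real.pi * A / B := rfl
    rw [mul_pow, Real.sq_sqrt hs.le, h5, momentLimit, mul_pow _ √(2 : ℝ), h4]
    ring
  rw [hM]
  have hK : 0 < momentLimit ^ 2 := pow_pos momentLimit_pos 2
  constructor
  · refine mul_le_mul_of_nonneg_left ?_ hK.le
    rw [div_mul_eq_mul_div, div_le_div_iff₀ (by linarith) (by positivity)]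
    nlinarith
  · refine mul_le_of_le_one_right hK.le ?_
    rw [div_mul_eq_mul_div, div_le_one (by positivity)]
    rw [div_mul_eq_mul_div, le_div_iff₀ (by linarith)] at h1
    nlinarith [sq_nonneg A]

lemma beamMoment_mul_sqrt_le {s : ℝ} (hs : 0 < s) : beamMoment s * √s ≤ momentLimit :=
  le_of_sq_le_sq (beamMoment_sq_bounds hs).2 momentLimit_pos.le

lemma le_beamMoment_mul_sqrt {s : ℝ} (hs : 0 < s) :
    momentLimit * √(s / (s + 2)) ≤ beamMoment s * √s := by
  refine le_of_sq_le_sq ?_ (mul_nonneg (beamMoment_pos hs.le).le (Real.sqrt_nonneg _))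
  rw [mul_pow, Real.sq_sqrt (by positivity)]
  exact (beamMoment_sq_bounds hs).1

lemma tendsto_beamMoment_mul_sqrt :
    Filter.Tendsto (fun s => beamMoment s * √s) Filter.atTop (nhds momentLimit) := by
  have h1 : Filter.Tendsto (fun s : ℝ => momentLimit * √(s / (s + 2))) Filter.atTop
      (nhds momentLimit) := by
    have h2 : Filter.Tendsto (fun s : ℝ => 1 - 2 / (s + 2)) Filter.atTop (nhds (1 - 0)) :=
      tendsto_const_nhds.sub (tendsto_const_nhds.div_atTop
        (Filter.tendsto_atTop_add_const_right _ _ Filter.tendsto_id))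
    have h3 : Filter.Tendsto (fun s : ℝ => s / (s + 2)) Filter.atTop (nhds 1) := by
      rw [sub_zero] at h2
      refine h2.congr' ?_
      filter_upwards [Filter.eventually_gt_atTop 0] with s hs
      field_simp; ring
    simpa using (h3.sqrt).const_mul momentLimit
  refine tendsto_of_tendsto_of_tendsto_of_le_of_le' h1 tendsto_const_nhds ?_ ?_
  · filter_upwards [Filter.eventually_gt_atTop 0] with s hs using le_beamMoment_mul_sqrt hs
  · filter_upwards [Filter.eventually_gt_atTop 0] with s hs using beamMoment_mul_sqrt_le hs

/-- The limit of `‖Q_k‖_p / k^σ(p)`. -/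
noncomputable def beamConstant (p : ℝ) : ℝ :=
  momentLimit ^ (1 / p) / momentLimit ^ (1 / 2 : ℝ) * (2 ^ (1 / 4 : ℝ) / p ^ (1 / (2 * p)))

lemma beamConstant_pos {p : ℝ} (hp : 0 < p) : 0 < beamConstant p := by
  have := momentLimit_pos
  unfold beamConstant; positivity

lemma beamMoment_rpow {k p a : ℝ} (hk : 0 < k) (hp : 0 < p) :
    beamMoment (k * p) ^ a =
      (beamMoment (k * p) * √(k * p)) ^ a / (k ^ (a / 2) * p ^ (a / 2)) := by
  have h : 0 < k * p := mul_pos hk hp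
  rw [Real.mul_rpow (beamMoment_pos h.le).le (Real.sqrt_nonneg _), Real.sqrt_eq_rpow,
    ← Real.rpow_mul h.le, Real.mul_rpow hk.le hp.le, show 1 / 2 * a = a / 2 by ring]
  field_simp

lemma sphereNorm_gaussianBeam_div {k : ℕ} (hk : 0 < k) {p : ℝ} (hp : 0 < p) :
    sphereNorm p (gaussianBeam k) / (k : ℝ) ^ soggeExponent p =
      (beamMoment (k * p) * √(k * p)) ^ (1 / p) / (beamMoment (k * 2) * √(k * 2)) ^ (1 / 2 : ℝ) *
        (2 ^ (1 / 4 : ℝ) / p ^ (1 / (2 * p))) := by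
  have hk' : (0 : ℝ) < k := by exact_mod_cast hk
  have h2 : (0 : ℝ) < (beamMoment (k * 2) * √(k * 2)) ^ (1 / 2 : ℝ) :=
    Real.rpow_pos_of_pos (mul_pos (beamMoment_pos (by positivity)) (by positivity)) _
  rw [sphereNorm_gaussianBeam k hp, beamMoment_rpow hk' hp, beamMoment_rpow hk' two_pos,
    show (1 / p / 2) = 1 / (2 * p) by field_simp, show (1 / 2 / 2 : ℝ) = 1 / 4 by norm_num,
    show soggeExponent p = 1 / 4 - 1 / (2 * p) by unfold soggeExponent; field_simp; ring,
    Real.rpow_sub hk']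
  field_simp

lemma tendsto_sphereNorm_gaussianBeam {p : ℝ} (hp : 0 < p) :
    Filter.Tendsto (fun k : ℕ => sphereNorm p (gaussianBeam k) / (k : ℝ) ^ soggeExponent p)
      Filter.atTop (nhds (beamConstant p)) := by
  have hlim : ∀ q : ℝ, 0 < q → ∀ a : ℝ, Filter.Tendsto
      (fun k : ℕ => (beamMoment (k * q) * √(k * q)) ^ a) Filter.atTop
      (nhds (momentLimit ^ a)) := fun q hq a =>
    (tendsto_beamMoment_mul_sqrt.comp
      (tendsto_natCast_atTop_atTop.atTop_mul_const hq)).rpow_const (Or.inl momentLimit_pos.ne')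
  refine Filter.Tendsto.congr' ?_ (((hlim p hp (1 / p)).div (hlim 2 two_pos (1 / 2))
    (Real.rpow_pos_of_pos momentLimit_pos _).ne').mul_const _)
  filter_upwards [Filter.eventually_gt_atTop 0] with k hk
  rw [sphereNorm_gaussianBeam_div hk hp]
  rfl

/-- A lower bound for the norms of the beams that is uniform in the exponent. -/
lemma beamConstant_mul_le {k : ℕ} (hk : 0 < k) {p : ℝ} (hp : 2 < p) :
    beamConstant p * (k : ℝ) ^ soggeExponent p ≤ 2 * sphereNorm p (gaussianBeam k) := by
  have hk' : (1 : ℝ) ≤ k := by exact_mod_cast hk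
  have hp0 : 0 < p := by linarith
  have hK := momentLimit_pos
  have hkp : 2 ≤ k * p := by nlinarith
  have h2 : 0 < beamMoment (k * 2) * √(k * 2) :=
    mul_pos (beamMoment_pos (by positivity)) (by positivity)
  -- Since `k p ≥ 2`, the factor `√(s / (s + 2))` at `s = k p` is at least `1 / 2`; its power `1 / p`
  -- is then no smaller than `1 / 2`, whatever `p` is.
  have h1 : momentLimit * (1 / 2) ≤ beamMoment (k * p) * √(k * p) := by
    refine le_trans ?_ (le_beamMoment_mul_sqrt (by linarith))
    refine mul_le_mul_of_nonneg_left (Real.le_sqrt_of_sq_le ?_) hK.le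
    rw [le_div_iff₀ (by linarith)]
    linarith
  have h3 : momentLimit ^ (1 / p) * (1 / 2) ≤ (beamMoment (k * p) * √(k * p)) ^ (1 / p) := by
    refine le_trans ?_ (Real.rpow_le_rpow (by positivity) h1 (by positivity))
    rw [Real.mul_rpow hK.le (by norm_num)]
    gcongr
    refine Real.self_le_rpow_of_le_one (by norm_num) (by norm_num) ?_
    rw [div_le_one hp0]; linarith
  have h4 : beamConstant p * (1 / 2) ≤
      sphereNorm p (gaussianBeam k) / (k : ℝ) ^ soggeExponent p := by
    rw [sphereNorm_gaussianBeam_div hk hp0, beamConstant, mul_right_comm, div_mul_eq_mul_div]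
    have h5 : 0 ≤ (beamMoment (k * p) * √(k * p)) ^ (1 / p) := le_trans (by positivity) h3
    have h6 := beamMoment_mul_sqrt_le (s := k * 2) (by positivity)
    gcongr
  rw [le_div_iff₀ (by positivity)] at h4
  linarith

/-! ### Orthonormalising a nearly orthogonal family -/

section GramSchmidt

open InnerProductSpace

variable {E : Type*} [NormedAddCommGroup E] [InnerProductSpace ℂ E]

/-- Off-diagonal smallness of the Gram matrix bounds the `ℓ¹` norm of the coefficients of the
orthogonal projection of one member of the family to the span of others. -/
lemma sum_norm_coeff_le {ι : Type*} [DecidableEq ι] {f : ι → E}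
    {ε : ℝ} (hε : ε < 1) (S : Finset ι) (hf : ∀ j ∈ S, ‖f j‖ = 1)
    (hG : ∀ i, ∑ j ∈ S.erase i, ‖inner ℂ (f j) (f i)‖ ≤ ε) {i : ι} (hi : i ∉ S) (c : ι → ℂ)
    (hc : ∀ j ∈ S, inner ℂ (f j) (f i - ∑ l ∈ S, c l • f l) = 0) :
    ∑ j ∈ S, ‖c j‖ ≤ ε / (1 - ε) := by
  have h1 : ∀ j ∈ S, ‖c j‖ ≤ ‖inner ℂ (f j) (f i)‖ +
      ∑ l ∈ S.erase j, ‖c l‖ * ‖inner ℂ (f j) (f l)‖ := by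
    intro j hj
    have h2 := hc j hj
    rw [inner_sub_right, inner_sum, ← Finset.add_sum_erase _ _ hj] at h2
    simp only [inner_smul_right, inner_self_eq_norm_sq_to_K, hf j hj] at h2
    have h3 : c j = inner ℂ (f j) (f i) - ∑ l ∈ S.erase j, c l * inner ℂ (f j) (f l) := by
      have h4 : ((1 : ℝ) : ℂ) ^ 2 = 1 := by norm_num
      have h5 := sub_eq_zero.1 h2
      rw [h5]
      simp
    calc ‖c j‖ = ‖inner ℂ (f j) (f i) - ∑ l ∈ S.erase j, c l * inner ℂ (f j) (f l)‖ := by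
          rw [← h3]
      _ ≤ ‖inner ℂ (f j) (f i)‖ + ‖∑ l ∈ S.erase j, c l * inner ℂ (f j) (f l)‖ := norm_sub_le _ _
      _ ≤ _ := by
          gcongr
          exact (norm_sum_le _ _).trans (Finset.sum_le_sum fun l _ => (norm_mul _ _).le)
  have h6 : ∑ j ∈ S, ∑ l ∈ S.erase j, ‖c l‖ * ‖inner ℂ (f j) (f l)‖ ≤ ∑ l ∈ S, ‖c l‖ * ε := by
    rw [Finset.sum_comm' (t' := S) (s' := fun l => S.erase l)
      (by intro x y; simp only [Finset.mem_erase]; tauto)]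
    refine Finset.sum_le_sum fun l _ => ?_
    rw [← Finset.mul_sum]
    exact mul_le_mul_of_nonneg_left (hG l) (norm_nonneg _)
  have h7 := Finset.sum_le_sum h1
  rw [Finset.sum_add_distrib] at h7
  have h8 := hG i
  rw [Finset.erase_eq_of_notMem hi] at h8
  rw [← Finset.sum_mul] at h6
  rw [le_div_iff₀ (by linarith)]
  linarith

/-- Gram–Schmidt applied to a nearly orthogonal family of unit vectors: every seminorm that takes
the same value on all members of the family loses only a bounded factor. -/
lemma exists_orthonormalBasis_of_nearly_orthogonal [FiniteDimensional ℂ E] {n N : ℕ}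
    (hn : Module.finrank ℂ E = n) (hN : N ≤ n) (q : Fin N → E) (hq : ∀ i, ‖q i‖ = 1) {ε : ℝ}
    (hε : ε < 1 / 2) (hG : ∀ i, ∑ j ∈ Finset.univ.erase i, ‖inner ℂ (q j) (q i)‖ ≤ ε) :
    ∃ b : OrthonormalBasis (Fin n) ℂ E, ∀ (ν : Seminorm ℂ E) (M : ℝ), (∀ i, ν (q i) = M) →
      ∀ i : Fin N, (1 - ε / (1 - ε)) * M ≤ ν (b (Fin.castLE hN i)) := by
  -- The family is padded with zeros, which Gram–Schmidt replaces by an orthonormal complement.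
  let f : Fin n → E := fun i => if h : i.1 < N then q ⟨i.1, h⟩ else 0
  have hfq : ∀ i, f (Fin.castLE hN i) = q i := fun i => by simp [f]
  refine ⟨gramSchmidtOrthonormalBasis (by simpa using hn) f, fun ν M hM i => ?_⟩
  set g := gramSchmidt ℂ f (Fin.castLE hN i) with hg
  have hspan : q i - g ∈ Submodule.span ℂ (q '' ((Finset.Iio i : Finset (Fin N)) : Set (Fin N))) := by
    have h1 : q i - g ∈ Submodule.span ℂ (gramSchmidt ℂ f '' Set.Iio (Fin.castLE hN i)) := by
      rw [← hfq i, gramSchmidt_def'' ℂ f (Fin.castLE hN i), ← hg, add_sub_cancel_left]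
      exact Submodule.sum_mem _ fun j hj => Submodule.smul_mem _ _
        (Submodule.subset_span ⟨j, Finset.mem_Iio.1 hj, rfl⟩)
    rw [span_gramSchmidt_Iio] at h1
    refine Submodule.span_mono ?_ h1
    rintro _ ⟨j, hj, rfl⟩
    have hjN : j.1 < N := lt_trans (Fin.lt_def.1 hj) i.2
    exact ⟨⟨j.1, hjN⟩, Finset.mem_coe.2 (Finset.mem_Iio.2 (Fin.lt_def.2 (Fin.lt_def.1 hj))),
      by simp [f, hjN]⟩
  obtain ⟨c, hc⟩ := (Submodule.mem_span_image_finset_iff_exists_fun' ℂ).1 hspan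
  have hgc : g = q i - ∑ l ∈ Finset.Iio i, c l • q l := by rw [hc]; abel
  have horth : ∀ j ∈ Finset.Iio i, inner ℂ (q j) g = 0 := by
    intro j hj
    have hj' := Finset.mem_Iio.1 hj
    rw [inner_eq_zero_symm, ← hfq j]
    exact gramSchmidt_inv_triangular ℂ f (Fin.lt_def.2 (Fin.lt_def.1 hj'))
  have hsum : ∑ j ∈ Finset.Iio i, ‖c j‖ ≤ ε / (1 - ε) := by
    refine sum_norm_coeff_le (by linarith) (Finset.Iio i) (fun j _ => hq j) (fun l => ?_)
      (by simp) c (fun j hj => hgc ▸ horth j hj)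
    refine le_trans ?_ (hG l)
    exact Finset.sum_le_sum_of_subset_of_nonneg
      (Finset.erase_subset_erase _ (Finset.subset_univ _)) fun _ _ _ => norm_nonneg _
  -- This bound serves twice: for the norm of `E`, where it shows that `g` does not vanish, and for `ν`.
  have hlower : ∀ (μ : Seminorm ℂ E) (M : ℝ), (∀ i, μ (q i) = M) →
      (1 - ε / (1 - ε)) * M ≤ μ g := by
    intro μ M hM
    have hM0 : 0 ≤ M := hM i ▸ apply_nonneg μ _
    have h1 : μ (∑ l ∈ Finset.Iio i, c l • q l) ≤ ε / (1 - ε) * M := by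
      calc μ (∑ l ∈ Finset.Iio i, c l • q l) ≤ ∑ l ∈ Finset.Iio i, μ (c l • q l) :=
            Finset.le_sum_of_subadditive μ (map_zero μ).le (map_add_le_add μ) _ _
        _ = (∑ l ∈ Finset.Iio i, ‖c l‖) * M := by
            rw [Finset.sum_mul]
            exact Finset.sum_congr rfl fun l _ => by rw [map_smul_eq_mul, hM]
        _ ≤ _ := by gcongr
    have h2 : μ (q i) ≤ μ g + μ (∑ l ∈ Finset.Iio i, c l • q l) := by
      calc μ (q i) = μ (g + ∑ l ∈ Finset.Iio i, c l • q l) := by rw [hgc, sub_add_cancel]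
        _ ≤ _ := map_add_le_add μ _ _
    rw [hM] at h2
    linarith
  have hgpos : 0 < ‖g‖ := by
    have h1 := hlower (normSeminorm ℂ E) 1 hq
    have h2 : ε / (1 - ε) < 1 := by rw [div_lt_one (by linarith)]; linarith
    rw [coe_normSeminorm] at h1
    linarith
  have hg1 : ‖g‖ ≤ 1 := by
    have h1 : inner ℂ g (q i) = inner ℂ g g := by
      have h2 : q i = g + ∑ l ∈ Finset.Iio i, c l • q l := by rw [hgc, sub_add_cancel]
      rw [h2, inner_add_right, inner_sum, Finset.sum_eq_zero, add_zero]
      intro l hl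
      rw [inner_smul_right, inner_eq_zero_symm.1 (horth l hl), mul_zero]
    have h3 : ‖inner ℂ g (q i)‖ ≤ ‖g‖ * ‖q i‖ := norm_inner_le_norm _ _
    rw [h1, hq, mul_one, inner_self_eq_norm_sq_to_K] at h3
    simp only [Complex.coe_algebraMap, norm_pow, Complex.norm_real, norm_norm] at h3
    nlinarith
  have hb : gramSchmidtOrthonormalBasis (by simpa using hn) f (Fin.castLE hN i) =
      ((‖g‖ : ℂ))⁻¹ • g := by
    have h1 : gramSchmidtNormed ℂ f (Fin.castLE hN i) = ((‖g‖ : ℂ))⁻¹ • g := rfl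
    rw [gramSchmidtOrthonormalBasis_apply, h1]
    rw [h1]
    exact smul_ne_zero (inv_ne_zero (by exact_mod_cast hgpos.ne')) (norm_pos_iff.1 hgpos)
  rw [hb, map_smul_eq_mul, norm_inv, Complex.norm_real, norm_norm]
  refine (hlower ν M hM).trans (le_mul_of_one_le_left (apply_nonneg ν _) ?_)
  exact (one_le_inv₀ hgpos).2 hg1

end GramSchmidt

/-! ### The Hilbert space of spherical harmonics -/

lemma continuous_of_mem_sphericalHarmonics {k : ℕ} {f : UnitSphere2 → ℂ}
    (hf : f ∈ sphericalHarmonics k) : Continuous f := by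
  obtain ⟨P, _, rfl⟩ := hf
  exact continuous_restrictToSphere P

lemma integrable_mul_conj {f g : UnitSphere2 → ℂ} (hf : Continuous f) (hg : Continuous g) :
    Integrable (fun x => f x * (starRingEnd ℂ) (g x)) surfaceMeasure :=
  (hf.mul (Complex.continuous_conj.comp hg)).integrable_of_hasCompactSupport
    (HasCompactSupport.of_compactSpace _)

lemma sphereInner_self (f : UnitSphere2 → ℂ) :
    sphereInner f f = ((∫ x, ‖f x‖ ^ 2 ∂surfaceMeasure : ℝ) : ℂ) := by
  rw [sphereInner, ← integral_complex_ofReal]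
  refine integral_congr_ae (Filter.Eventually.of_forall fun x => ?_)
  simp [Complex.mul_conj']

lemma sphereInner_self_eq_sphereNorm {f : UnitSphere2 → ℂ} (hf : Continuous f) :
    sphereInner f f = ((sphereNorm 2 f ^ 2 : ℝ) : ℂ) := by
  rw [sphereInner_self, sphereNorm_eq_integral hf two_pos, ← Real.sqrt_eq_rpow, Real.sq_sqrt]
  · simp only [Real.rpow_two]
  · exact integral_nonneg fun x => by positivity

/-- The `L²` inner product on the spherical harmonics of degree `k`. It is conjugate-linear in the
first variable, whereas `sphereInner` is conjugate-linear in the second. -/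
noncomputable abbrev sphericalHarmonicsCore (k : ℕ) :
    InnerProductSpace.Core ℂ (sphericalHarmonics k) where
  inner f g := sphereInner g.1 f.1
  conj_inner_symm f g := by
    rw [sphereInner, sphereInner, ← integral_conj]
    simp [mul_comm]
  re_inner_nonneg f := by
    rw [sphereInner_self]
    exact integral_nonneg fun x => by positivity
  add_left f g h := by
    have hf := continuous_of_mem_sphericalHarmonics f.2
    have hg := continuous_of_mem_sphericalHarmonics g.2
    have hh := continuous_of_mem_sphericalHarmonics h.2
    simp only [sphereInner]
    rw [← integral_add (integrable_mul_conj hh hf) (integrable_mul_conj hh hg)]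
    simp [mul_add]
  smul_left f g c := by
    simp only [sphereInner]
    rw [← integral_const_mul]
    simp [mul_left_comm]
  definite f h := by
    have hf := continuous_of_mem_sphericalHarmonics f.2
    rw [sphereInner_self, Complex.ofReal_eq_zero] at h
    have h2 : (fun x => ‖f.1 x‖ ^ 2) = 0 := (Continuous.ae_eq_iff_eq surfaceMeasure (by fun_prop)
      continuous_zero).1 ((integral_eq_zero_iff_of_nonneg (fun x => by positivity)
        ((by fun_prop : Continuous fun x => ‖f.1 x‖ ^ 2).integrable_of_hasCompactSupport
          (HasCompactSupport.of_compactSpace _))).1 h)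
    ext x
    simpa using congr_fun h2 x

noncomputable instance (k : ℕ) : NormedAddCommGroup (sphericalHarmonics k) :=
  (sphericalHarmonicsCore k).toNormedAddCommGroup

noncomputable instance (k : ℕ) : InnerProductSpace ℂ (sphericalHarmonics k) :=
  InnerProductSpace.ofCore (sphericalHarmonicsCore k).toCore

lemma inner_sphericalHarmonics {k : ℕ} (f g : sphericalHarmonics k) :
    inner ℂ f g = sphereInner g.1 f.1 := rfl

lemma isSphericalHarmonicBasis_of_orthonormalBasis {k : ℕ}
    (b : OrthonormalBasis (Fin (2 * k + 1)) ℂ (sphericalHarmonics k)) :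
    IsSphericalHarmonicBasis k fun i => (b i).1 where
  mem i := (b i).2
  orthonormal i j := by
    rw [← inner_sphericalHarmonics, orthonormal_iff_ite.1 b.orthonormal]
    simp [eq_comm]
  span_eq := by
    have h : Set.range (fun i => (b i).1) = (sphericalHarmonics k).subtype '' Set.range b := by
      rw [← Set.range_comp]; rfl
    rw [h, Submodule.span_image, ← b.coe_toBasis, b.toBasis.span_eq, Submodule.map_top,
      Submodule.range_subtype]

/-- The `L^p` norm as a seminorm on spherical harmonics. -/
noncomputable def sphereSeminorm (k : ℕ) {p : ℝ} (hp : 1 ≤ p) : Seminorm ℂ (sphericalHarmonics k) :=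
  Seminorm.of (fun f => sphereNorm p f.1)
    (fun f g => by
      have hf := memLp_of_continuous_sphere (continuous_of_mem_sphericalHarmonics f.2)
        (ENNReal.ofReal p)
      have hg := memLp_of_continuous_sphere (continuous_of_mem_sphericalHarmonics g.2)
        (ENNReal.ofReal p)
      rw [sphereNorm, sphereNorm, sphereNorm,
        ← ENNReal.toReal_add hf.eLpNorm_ne_top hg.eLpNorm_ne_top]
      exact ENNReal.toReal_mono (ENNReal.add_ne_top.2 ⟨hf.eLpNorm_ne_top, hg.eLpNorm_ne_top⟩)
        (eLpNorm_add_le hf.1 hg.1 (by simpa using hp)))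
    (fun c f => sphereNorm_const_mul p c f.1)

/-! ### Rotated Gaussian beams -/

/-- The isotropic vectors `(1 - z², i(1 + z²), 2z) / (1 + |z|²)`, a parametrisation of the
directions of Gaussian beams by stereographic coordinates of their poles. -/
noncomputable def beamVector (z : ℂ) : Fin 3 → ℂ :=
  ((1 + ‖z‖ ^ 2 : ℝ) : ℂ)⁻¹ • ![1 - z ^ 2, Complex.I * (1 + z ^ 2), 2 * z]

lemma beamVector_isotropic (z : ℂ) : beamVector z ⬝ᵥ beamVector z = 0 := by
  rw [beamVector, smul_dotProduct, dotProduct_smul]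
  simp only [dotProduct, Fin.sum_univ_three, Matrix.cons_val]
  have : (1 - z ^ 2) * (1 - z ^ 2) + Complex.I * (1 + z ^ 2) * (Complex.I * (1 + z ^ 2)) +
      2 * z * (2 * z) = 0 := by
    linear_combination (1 + z ^ 2) ^ 2 * Complex.I_sq
  simp [this]

lemma beamVector_dot_star (z ζ : ℂ) : beamVector z ⬝ᵥ star (beamVector ζ) =
    2 * ((1 + z * star ζ) ^ 2 / ((1 + ‖z‖ ^ 2 : ℝ) * (1 + ‖ζ‖ ^ 2 : ℝ))) := by
  rw [beamVector, beamVector, star_smul, smul_dotProduct, dotProduct_smul]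
  simp only [dotProduct, Fin.sum_univ_three, Matrix.cons_val, Pi.star_apply, smul_eq_mul]
  simp only [Complex.star_def, map_inv₀, Complex.conj_ofReal, map_sub, map_add, map_mul, map_pow,
    map_one, Complex.conj_I, map_ofNat]
  have : (1 - z ^ 2) * (1 - (starRingEnd ℂ) ζ ^ 2) + Complex.I * (1 + z ^ 2) *
      (-Complex.I * (1 + (starRingEnd ℂ) ζ ^ 2)) + 2 * z * (2 * (starRingEnd ℂ) ζ) =
      2 * (1 + z * (starRingEnd ℂ) ζ) ^ 2 := by
    linear_combination (-(1 + z ^ 2) * (1 + (starRingEnd ℂ) ζ ^ 2)) * Complex.I_sq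
  rw [this]
  ring

lemma norm_one_add_mul_star_sq (z ζ : ℂ) :
    ‖1 + z * star ζ‖ ^ 2 = (1 + ‖z‖ ^ 2) * (1 + ‖ζ‖ ^ 2) - ‖z - ζ‖ ^ 2 := by
  simp only [Complex.sq_norm, Complex.normSq_apply, Complex.add_re, Complex.add_im, Complex.mul_re,
    Complex.mul_im, Complex.one_re, Complex.one_im, Complex.star_def, Complex.conj_re,
    Complex.conj_im, Complex.sub_re, Complex.sub_im]
  ring

lemma beamVector_dot_star_self (z : ℂ) : beamVector z ⬝ᵥ star (beamVector z) = 2 := by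
  have h : ((1 + ‖z‖ ^ 2 : ℝ) : ℂ) ≠ 0 := by
    exact_mod_cast (by positivity : (1 + ‖z‖ ^ 2 : ℝ) ≠ 0)
  have h2 : 1 + z * star z = ((1 + ‖z‖ ^ 2 : ℝ) : ℂ) := by
    rw [Complex.star_def, Complex.mul_conj']; push_cast; ring
  rw [beamVector_dot_star, h2]
  field_simp

lemma polyLaplacian_dotForm_pow {w : Fin 3 → ℂ} (hw : w ⬝ᵥ w = 0) (k : ℕ) :
    polyLaplacian (dotForm w ^ k) = 0 := by
  have h1 : ∀ i, MvPolynomial.pderiv i (MvPolynomial.pderiv i (dotForm w ^ k)) =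
      ((k : ℂ) * ((k - 1 : ℕ) : ℂ) * (w i * w i)) • dotForm w ^ (k - 1 - 1) := by
    intro i
    rw [Derivation.leibniz_pow, pderiv_dotForm, map_nsmul, smul_eq_mul, Derivation.leibniz,
      Derivation.leibniz_pow, pderiv_dotForm, MvPolynomial.pderiv_C]
    simp only [MvPolynomial.smul_eq_C_mul, smul_eq_mul, nsmul_eq_mul, map_mul, map_natCast,
      mul_zero, zero_add]
    ring
  have h2 : ∑ i, w i * w i = 0 := hw
  simp only [polyLaplacian, LinearMap.sum_apply, LinearMap.comp_apply, Derivation.coeFn_coe, h1,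
    ← Finset.sum_smul, ← Finset.mul_sum, h2, mul_zero, zero_smul]

/-- The Gaussian beam with pole at stereographic coordinate `z`. -/
noncomputable def rotatedBeam (k : ℕ) (z : ℂ) : sphericalHarmonics k :=
  ((sphereNorm 2 (sectoralHarmonic k) : ℂ))⁻¹ •
    ⟨restrictToSphere (dotForm (beamVector z) ^ k), dotForm (beamVector z) ^ k,
      ⟨isHomogeneous_dotForm_pow _ k, polyLaplacian_dotForm_pow (beamVector_isotropic z) k⟩, rfl⟩

lemma sphereNorm_rotatedBeam (k : ℕ) (z : ℂ) {p : ℝ} (hp : 0 < p) :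
    sphereNorm p (rotatedBeam k z).1 = sphereNorm p (gaussianBeam k) := by
  have h : gaussianBeam k = fun x =>
    ((sphereNorm 2 (sectoralHarmonic k) : ℂ))⁻¹ * sectoralHarmonic k x := rfl
  have h2 : (rotatedBeam k z).1 = fun x => ((sphereNorm 2 (sectoralHarmonic k) : ℂ))⁻¹ *
    restrictToSphere (dotForm (beamVector z) ^ k) x := rfl
  rw [h, h2, sphereNorm_const_mul, sphereNorm_const_mul, sectoralHarmonic_eq,
    sphereNorm_dotForm_pow sectoralVector_isotropic sectoralVector_dot_star k hp,
    sphereNorm_dotForm_pow (beamVector_isotropic z) (beamVector_dot_star_self z) k hp]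

lemma sphereNorm_two_gaussianBeam (k : ℕ) : sphereNorm 2 (gaussianBeam k) = 1 := by
  rw [sphereNorm_gaussianBeam k two_pos]
  exact div_self (Real.rpow_pos_of_pos (beamMoment_pos (by positivity)) _).ne'

lemma inner_rotatedBeam_self (k : ℕ) (z : ℂ) :
    inner ℂ (rotatedBeam k z) (rotatedBeam k z) = (1 : ℂ) := by
  rw [inner_sphericalHarmonics, sphereInner_self_eq_sphereNorm
    (continuous_of_mem_sphericalHarmonics (rotatedBeam k z).2), sphereNorm_rotatedBeam k z two_pos,
    sphereNorm_two_gaussianBeam]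
  norm_num

lemma norm_rotatedBeam (k : ℕ) (z : ℂ) : ‖rotatedBeam k z‖ = 1 := by
  rw [norm_eq_sqrt_re_inner (𝕜 := ℂ), inner_rotatedBeam_self]
  simp

/-- The overlap of two Gaussian beams. The quantity subtracted from `1` is a quarter of the squared
chordal distance of the poles. The constant in `exists_sphereInner_dotForm_pow` is eliminated by
comparison with the case `z = ζ = 0`. -/
lemma norm_inner_rotatedBeam (k : ℕ) (z ζ : ℂ) :
    ‖inner ℂ (rotatedBeam k ζ) (rotatedBeam k z)‖ =
      (1 - ‖z - ζ‖ ^ 2 / ((1 + ‖z‖ ^ 2) * (1 + ‖ζ‖ ^ 2))) ^ k := by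
  obtain ⟨c, hc⟩ := exists_sphereInner_dotForm_pow k
  let a : ℂ := ((sphereNorm 2 (sectoralHarmonic k) : ℂ))⁻¹
  let F : ℂ → sphericalHarmonics k := fun z =>
    ⟨restrictToSphere (dotForm (beamVector z) ^ k), dotForm (beamVector z) ^ k,
      ⟨isHomogeneous_dotForm_pow _ k, polyLaplacian_dotForm_pow (beamVector_isotropic z) k⟩, rfl⟩
  have h1 : ∀ z ζ : ℂ, inner ℂ (rotatedBeam k ζ) (rotatedBeam k z) =
      (starRingEnd ℂ a * a * c) * (beamVector z ⬝ᵥ star (beamVector ζ)) ^ k := by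
    intro z ζ
    have h2 : inner ℂ (F ζ) (F z) = c * (beamVector z ⬝ᵥ star (beamVector ζ)) ^ k :=
      hc _ _ (beamVector_isotropic z)
    have h3 : ∀ z, rotatedBeam k z = a • F z := fun _ => rfl
    rw [h3, h3, inner_smul_left, inner_smul_right, h2]
    ring
  have h4 := h1 0 0
  rw [inner_rotatedBeam_self, beamVector_dot_star_self] at h4
  have h5 : inner ℂ (rotatedBeam k ζ) (rotatedBeam k z) =
      ((1 + z * star ζ) ^ 2 / ((1 + ‖z‖ ^ 2 : ℝ) * (1 + ‖ζ‖ ^ 2 : ℝ))) ^ k := by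
    rw [h1, beamVector_dot_star, mul_pow, ← mul_assoc, ← h4, one_mul]
  have hz : 0 < 1 + ‖z‖ ^ 2 := by positivity
  have hζ : 0 < 1 + ‖ζ‖ ^ 2 := by positivity
  rw [h5, norm_pow, norm_div, norm_pow, norm_mul, Complex.norm_real, Complex.norm_real,
    Real.norm_of_nonneg hz.le, Real.norm_of_nonneg hζ.le, norm_one_add_mul_star_sq, sub_div,
    div_self (mul_pos hz hζ).ne']

lemma norm_inner_rotatedBeam_le (k : ℕ) {z ζ : ℂ} (hz : ‖z‖ ^ 2 ≤ 2) (hζ : ‖ζ‖ ^ 2 ≤ 2) :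
    ‖inner ℂ (rotatedBeam k ζ) (rotatedBeam k z)‖ ≤ Real.exp (-(k * ‖z - ζ‖ ^ 2 / 9)) := by
  rw [norm_inner_rotatedBeam]
  have h0 : 0 ≤ 1 - ‖z - ζ‖ ^ 2 / ((1 + ‖z‖ ^ 2) * (1 + ‖ζ‖ ^ 2)) := by
    have h := norm_one_add_mul_star_sq z ζ
    have h2 : 0 ≤ ‖1 + z * star ζ‖ ^ 2 := by positivity
    rw [sub_nonneg, div_le_one (by positivity)]
    linarith
  have h1 : ‖z - ζ‖ ^ 2 / 9 ≤ ‖z - ζ‖ ^ 2 / ((1 + ‖z‖ ^ 2) * (1 + ‖ζ‖ ^ 2)) := by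
    gcongr
    nlinarith [sq_nonneg ‖z‖, sq_nonneg ‖ζ‖]
  calc _ ≤ Real.exp (-(‖z - ζ‖ ^ 2 / 9)) ^ k := by
        refine pow_le_pow_left₀ h0 ?_ k
        have := Real.add_one_le_exp (-(‖z - ζ‖ ^ 2 / 9))
        linarith
    _ = _ := by
        rw [← Real.exp_nat_mul]; congr 1; ring

/-! ### A lattice of poles -/

/-- The point of index `(m, n)` of the square lattice of mesh `1 / M` in the unit square. -/
noncomputable def latticePoint (M : ℕ) (a : Fin M × Fin M) : ℂ :=
  ⟨(a.1 : ℝ) / M, (a.2 : ℝ) / M⟩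

lemma norm_latticePoint_sq_le {M : ℕ} (a : Fin M × Fin M) : ‖latticePoint M a‖ ^ 2 ≤ 2 := by
  have h : ∀ i : Fin M, 0 ≤ (i : ℝ) / M ∧ (i : ℝ) / M ≤ 1 := fun i =>
    ⟨by positivity, div_le_one_of_le₀ (by exact_mod_cast i.2.le) (by positivity)⟩
  rw [Complex.sq_norm, Complex.normSq_apply, latticePoint]
  nlinarith [h a.1, h a.2]

lemma norm_latticePoint_sub_sq {M : ℕ} (a b : Fin M × Fin M) :
    ‖latticePoint M a - latticePoint M b‖ ^ 2 =
      (((a.1 : ℝ) - b.1) ^ 2 + ((a.2 : ℝ) - b.2) ^ 2) / M ^ 2 := by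
  rw [Complex.sq_norm, Complex.normSq_apply, latticePoint, latticePoint]
  simp only [Complex.sub_re, Complex.sub_im]
  ring

lemma natDist_le_sub_sq (m n : ℕ) : (Nat.dist m n : ℝ) ≤ ((m : ℝ) - n) ^ 2 := by
  have h : (Nat.dist m n : ℝ) = |(m : ℝ) - n| := by
    rcases le_total m n with h | h
    · rw [Nat.dist_eq_sub_of_le h, Nat.cast_sub h, abs_sub_comm, abs_of_nonneg]
      exact sub_nonneg.2 (by exact_mod_cast h)
    · rw [Nat.dist_eq_sub_of_le_right h, Nat.cast_sub h, abs_of_nonneg]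
      exact sub_nonneg.2 (by exact_mod_cast h)
  have h2 : Nat.dist m n ≤ Nat.dist m n ^ 2 := Nat.le_self_pow two_ne_zero _
  rw [← sq_abs, ← h]
  exact_mod_cast h2

lemma exp_neg_three_le : Real.exp (-3) ≤ 1 / 20 := by
  have h : (20 : ℝ) ≤ Real.exp 3 := by
    have h1 := Real.exp_one_gt_d9
    have h2 : Real.exp 3 = Real.exp 1 ^ 3 := by rw [← Real.exp_nat_mul]; norm_num
    rw [h2]
    calc (20 : ℝ) ≤ 2.7182818283 ^ 3 := by norm_num
      _ ≤ _ := by gcongr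
  rw [Real.exp_neg, ← one_div]
  gcongr

lemma sum_pow_natDist_le {r : ℝ} (hr : 0 ≤ r) (hr1 : r < 1) {M : ℕ} (m : Fin M) :
    ∑ n : Fin M, r ^ Nat.dist n m ≤ (1 + r) / (1 - r) := by
  have hgeom : ∀ n : ℕ, ∑ i ∈ Finset.range n, r ^ i ≤ 1 / (1 - r) := fun n => by
    rw [one_div, ← tsum_geometric_of_lt_one hr hr1]
    exact (summable_geometric_of_lt_one hr hr1).sum_le_tsum _ fun i _ => by positivity
  rw [Fin.sum_univ_eq_sum_range (fun n => r ^ Nat.dist n m), Finset.range_eq_Ico,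
    ← Finset.sum_Ico_consecutive _ (Nat.zero_le m.1) m.2.le, ← Finset.range_eq_Ico,
    Finset.sum_Ico_eq_sum_range, ← Finset.sum_range_reflect]
  have h1 : ∑ j ∈ Finset.range m.1, r ^ Nat.dist (m.1 - 1 - j) m =
      r * ∑ j ∈ Finset.range m.1, r ^ j := by
    rw [Finset.mul_sum]
    refine Finset.sum_congr rfl fun j hj => ?_
    have := Finset.mem_range.1 hj
    rw [← pow_succ', Nat.dist_eq_sub_of_le (by omega)]
    congr 1; omega
  have h2 : ∑ j ∈ Finset.range (M - m.1), r ^ Nat.dist (m.1 + j) m =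
      ∑ j ∈ Finset.range (M - m.1), r ^ j := by
    refine Finset.sum_congr rfl fun j _ => ?_
    rw [Nat.dist_eq_sub_of_le_right (by omega)]
    congr 1; omega
  rw [h1, h2]
  calc _ ≤ r * (1 / (1 - r)) + 1 / (1 - r) := by gcongr <;> exact hgeom _
    _ = _ := by ring

lemma norm_inner_latticeBeam_le {k M : ℕ} (hM : 0 < M) (hk : 27 * M ^ 2 ≤ k)
    (a b : Fin M × Fin M) :
    ‖inner ℂ (rotatedBeam k (latticePoint M b)) (rotatedBeam k (latticePoint M a))‖ ≤
      Real.exp (-3) ^ Nat.dist b.1 a.1 * Real.exp (-3) ^ Nat.dist b.2 a.2 := by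
  refine (norm_inner_rotatedBeam_le k (norm_latticePoint_sq_le a)
    (norm_latticePoint_sq_le b)).trans ?_
  rw [← pow_add, ← Real.exp_nat_mul, norm_latticePoint_sub_sq]
  refine Real.exp_le_exp.2 ?_
  have hM' : (0 : ℝ) < M ^ 2 := by positivity
  have hk' : (27 : ℝ) * M ^ 2 ≤ k := by exact_mod_cast hk
  have h1 := natDist_le_sub_sq b.1 a.1
  have h2 := natDist_le_sub_sq b.2 a.2
  set S := ((a.1 : ℝ) - b.1) ^ 2 + ((a.2 : ℝ) - b.2) ^ 2 with hS
  have hS0 : 0 ≤ S := by positivity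
  have h3 : 3 * S ≤ k * (S / M ^ 2) / 9 := by
    rw [le_div_iff₀ (by norm_num), mul_div_assoc', le_div_iff₀ hM']
    nlinarith
  push_cast
  nlinarith

/-- The beams with poles in the lattice are nearly orthogonal: the row sums of overlaps are at most
products of two geometric sums, one for each lattice direction. -/
lemma sum_norm_inner_latticeBeam_le {k M : ℕ} (hk : 27 * M ^ 2 ≤ k)
    (a : Fin M × Fin M) :
    ∑ b ∈ Finset.univ.erase a,
      ‖inner ℂ (rotatedBeam k (latticePoint M b)) (rotatedBeam k (latticePoint M a))‖ ≤ 1 / 4 := by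
  have hM : 0 < M := a.1.pos
  have hr := exp_neg_three_le
  set r := Real.exp (-3) with hr_def
  have hr0 : 0 < r := Real.exp_pos _
  have h1 : ∀ m : Fin M, ∑ n : Fin M, r ^ Nat.dist n m ≤ 21 / 19 := fun m => by
    refine (sum_pow_natDist_le hr0.le (by linarith) m).trans ?_
    rw [div_le_div_iff₀ (by linarith) (by norm_num)]
    linarith
  have h2 : ∑ b : Fin M × Fin M, r ^ Nat.dist b.1 a.1 * r ^ Nat.dist b.2 a.2 ≤
      21 / 19 * (21 / 19) := by
    rw [Fintype.sum_prod_type]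
    change ∑ m : Fin M, ∑ n : Fin M, r ^ Nat.dist m a.1 * r ^ Nat.dist n a.2 ≤ _
    rw [← Fintype.sum_mul_sum]
    exact mul_le_mul (h1 _) (h1 _) (Finset.sum_nonneg fun _ _ => by positivity) (by norm_num)
  rw [← Finset.add_sum_erase _ _ (Finset.mem_univ a), Nat.dist_self, Nat.dist_self] at h2
  calc _ ≤ ∑ b ∈ Finset.univ.erase a, r ^ Nat.dist b.1 a.1 * r ^ Nat.dist b.2 a.2 :=
        Finset.sum_le_sum fun b _ => norm_inner_latticeBeam_le hM hk a b
    _ ≤ 1 / 4 := by norm_num at h2 ⊢; linarith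

/-! ### Bases with large average norm -/

/-- Gram–Schmidt applied to the `M²` beams of the lattice: with off-diagonal row sums at most `1/4`,
each of the corresponding basis elements keeps two thirds of the norm of a beam. -/
lemma exists_basis_large_norm {k M : ℕ} (hk : 27 * M ^ 2 ≤ k) :
    ∃ u : Fin (2 * k + 1) → UnitSphere2 → ℂ, IsSphericalHarmonicBasis k u ∧
      ∀ p : ℝ, 1 ≤ p →
        2 / 3 * M ^ 2 * sphereNorm p (gaussianBeam k) ≤ ∑ i, sphereNorm p (u i) := by
  have hN : M * M ≤ 2 * k + 1 := by nlinarith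
  let e : Fin (M * M) ≃ Fin M × Fin M := finProdFinEquiv.symm
  obtain ⟨b, hb⟩ := exists_orthonormalBasis_of_nearly_orthogonal (finrank_sphericalHarmonics k) hN
    (fun i => rotatedBeam k (latticePoint M (e i))) (fun i => norm_rotatedBeam _ _)
    (ε := 1 / 4) (by norm_num) (fun i => by
      refine le_trans (le_of_eq ?_) (sum_norm_inner_latticeBeam_le hk (e i))
      exact Finset.sum_equiv e (by simp) fun _ _ => rfl)
  refine ⟨fun i => (b i).1, isSphericalHarmonicBasis_of_orthonormalBasis b, fun p hp => ?_⟩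
  have h1 : ∀ i : Fin (M * M), 2 / 3 * sphereNorm p (gaussianBeam k) ≤
      sphereNorm p (b (Fin.castLE hN i)).1 := fun i => by
    have := hb (sphereSeminorm k hp) (sphereNorm p (gaussianBeam k))
      (fun j => sphereNorm_rotatedBeam k _ (by linarith)) i
    norm_num at this
    exact this
  calc 2 / 3 * M ^ 2 * sphereNorm p (gaussianBeam k)
      = ∑ _i : Fin (M * M), 2 / 3 * sphereNorm p (gaussianBeam k) := by
        rw [Finset.sum_const, Finset.card_univ, Fintype.card_fin, nsmul_eq_mul]
        push_cast; ring
    _ ≤ ∑ i : Fin (M * M), sphereNorm p (b (Fin.castLEEmb hN i)).1 :=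
        Finset.sum_le_sum fun i _ => h1 i
    _ = ∑ i ∈ Finset.univ.map (Fin.castLEEmb hN), sphereNorm p (b i).1 := by
        rw [Finset.sum_map]
    _ ≤ _ := Finset.sum_le_univ_sum_of_nonneg fun i => sphereNorm_nonneg _ _

/-- Only this upper bound on the admissible densities is needed: the lattice of beams has a larger
density in the basis. -/
lemma IsAdmissibleDensity.le {D : ℝ} (hD : IsAdmissibleDensity D) : D ≤ 1 / 360 := by
  obtain ⟨h0, _, h⟩ := hD
  by_contra! hc
  have h1 : Real.exp (-5) ≤ Real.exp (1 / 72) ^ (-1 / D) := by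
    rw [← Real.exp_mul]
    refine Real.exp_le_exp.2 ?_
    rw [mul_div_assoc', le_div_iff₀ h0]
    linarith
  have h2 : (1 : ℝ) / 149 ≤ Real.exp (-5) := by
    have h3 := Real.exp_one_lt_d9
    have h4 : Real.exp 5 = Real.exp 1 ^ 5 := by rw [← Real.exp_nat_mul]; norm_num
    rw [Real.exp_neg, ← one_div]
    refine one_div_le_one_div_of_le (Real.exp_pos _) ?_
    rw [h4]
    calc Real.exp 1 ^ 5 ≤ 2.7182818286 ^ 5 := by gcongr
      _ ≤ 149 := by norm_num
  nlinarith

lemma isAdmissibleDensity_one_div_four_hundred : IsAdmissibleDensity (1 / 400) := by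
  refine ⟨by norm_num, by norm_num, ?_⟩
  have h1 : Real.exp (1 / 72) ^ (-1 / (1 / 400) : ℝ) = (Real.exp (50 / 9))⁻¹ := by
    rw [← Real.exp_mul, ← Real.exp_neg]; norm_num
  have h2 : (256 : ℝ) ≤ Real.exp (50 / 9) := by
    rw [← Real.log_le_iff_le_exp (by norm_num), show (256 : ℝ) = 2 ^ 8 by norm_num, Real.log_pow]
    have := Real.log_two_lt_d9
    norm_num at this ⊢
    linarith
  rw [h1, ← div_eq_mul_inv, div_le_div_iff₀ (Real.exp_pos _) (by norm_num)]
  linarith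

theorem mainTheorem3 :
    IsAdmissibleDensity (1 / 400) ∧
    ∃ C : ℝ → ℝ,
      (∀ p : ℝ, 2 < p → p ≤ 6 →
        0 < C p ∧
        Filter.Tendsto (fun k : ℕ => sphereNorm p (gaussianBeam k) / (k : ℝ) ^ soggeExponent p)
          Filter.atTop (nhds (C p))) ∧
      ∀ D : ℝ, IsAdmissibleDensity D →
        ∃ k₀ : ℕ, ∀ k : ℕ, k₀ ≤ k →
          ∃ u : Fin (2 * k + 1) → UnitSphere2 → ℂ,
            IsSphericalHarmonicBasis k u ∧
            ∀ p : ℝ, 2 < p → p ≤ 6 →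
              (D / 3) * sphereNorm p (gaussianBeam k) ≤
                (1 / (2 * (k : ℝ) + 1)) * ∑ i, sphereNorm p (u i) ∧
              (D / 3) * (C p * (k : ℝ) ^ soggeExponent p) ≤
                (1 / (2 * (k : ℝ) + 1)) * ∑ i, sphereNorm p (u i) := by
  refine ⟨isAdmissibleDensity_one_div_four_hundred, beamConstant, fun p hp _ =>
    ⟨beamConstant_pos (by linarith), tendsto_sphereNorm_gaussianBeam (by linarith)⟩,
    fun D hD => ⟨27, fun k hk => ?_⟩⟩
  -- The largest lattice whose mesh is still wide enough for near orthogonality of the beams.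
  set M := Nat.sqrt (k / 27) with hM_def
  have hM1 : 27 * M ^ 2 ≤ k := by
    have := Nat.sqrt_le' (k / 27)
    rw [← hM_def] at this
    omega
  have hM2 : k < 108 * M ^ 2 := by
    have h1 := Nat.lt_succ_sqrt' (k / 27)
    have h2 : 1 ≤ M := Nat.le_sqrt'.2 (by omega)
    rw [← hM_def, Nat.succ_eq_add_one] at h1
    have h3 : (M + 1) ^ 2 ≤ 4 * M ^ 2 := by nlinarith
    omega
  obtain ⟨u, hu, hsum⟩ := exists_basis_large_norm hM1
  refine ⟨u, hu, fun p hp _ => ?_⟩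
  have hD0 := hD.1
  have hD1 := hD.le
  have hB := sphereNorm_nonneg p (gaussianBeam k)
  have hC := beamConstant_mul_le (k := k) (by omega) hp
  have hS := hsum p (by linarith)
  have hk1 : (27 : ℝ) ≤ k := by exact_mod_cast hk
  have hM3 : (k : ℝ) < 108 * M ^ 2 := by exact_mod_cast hM2
  set B := sphereNorm p (gaussianBeam k)
  -- The lattice has at least `(2 k + 1) / 324` points, so the average is at least `B / 486`.
  have hav : B / 486 ≤ (1 / (2 * (k : ℝ) + 1)) * ∑ i, sphereNorm p (u i) := by
    rw [one_div_mul_eq_div, le_div_iff₀ (by linarith)]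
    refine le_trans ?_ hS
    nlinarith
  constructor
  · refine le_trans ?_ hav
    nlinarith
  · refine le_trans ?_ hav
    nlinarith
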